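/- Let $\alpha>-1$, let $m,n\ge 0$ be integers, and let $\omega_0,\dots,\omega_m$ be real numbers, not all zero, with $\sum_{k=0}^{\ell}\omega_k\ge 0$ for $\ell=0,\dots,m$. For $\vec t=(t_1,\dots,t_m)$ with $0<t_1<\cdots<t_m$ put $w_0(x)=x^{\alpha}e^{-x}$ and $$w(x;\vec t)=w_0(x)\Big(\omega_0+\sum_{k=1}^m\omega_k\theta(x-t_k)\Big),\qquad \theta(x)=\begin{cases}1,&x>0,\\0,&x\le 0.\end{cases}$$ Let $D_n(\vec t)=\det\big(\int_0^\infty x^{i+j}w(x;\vec t)\,dx\big)_{i,j=0}^{n-1}$ (with $D_0=1$), and let $P_j(\cdot;\vec t)$, $j\ge 0$, be the monic polynomials obtained from $1,x,x^2,\dots$ by orthogonalization with respect to $w$, with $h_j=\int_0^\infty P_j^2w\,dx$. Put $$R_{n,k}=\omega_k\frac{w_0(t_k)}{h_n}P_n^2(t_k),\qquad r_{n,k}=\omega_k\frac{w_0(t_k)}{h_{n-1}}P_n(t_k)P_{n-1}(t_k)\quad(n\ge1),\qquad r_{0,k}=0,$$ for $k=1,\dots,m$, and $\delta=\sum_{k=1}^m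 t_k\partial_{t_k}$, $\sigma_n=\delta\ln D_n$. Let $\mathrm{sgn}(x)$ be $1$, $-1$, $0$ for $x>0$, $x<0$, $x=0$. Then, at every $\vec t$ with $0<t_1<\cdots<t_m$, the moments of $w$ exist, $P_j$ is monic of degree $j$, $\int_0^\infty P_iP_jw\,dx=h_j\delta_{ij}$ and $h_j>0$ for all $i,j\ge0$, $D_n>0$, the functions $D_n,\sigma_n,R_{n,k},r_{n,k}$ of $\vec t$ are $C^\infty$ at $\vec t$, and the following hold. (1) For $k=1,\dots,m$, $$\delta R_{n,k}=2r_{n,k}+\Big(\sum_{j=1}^m t_jR_{n,j}-t_k+2n+\alpha\Big)R_{n,k}.$$ (2) Suppose that at $\vec t$ we have $\sum_{j=1}^mR_{n,j}\ne1$ and $R_{n,k}\neq0$ for every $k$ with $\omega_k\ne0$. (If $\omega_k=0$, then $R_{n,k}$ and $r_{n,k}$ vanish identically and quotients with denominator $R_{n,k}$ or $2R_{n,k}$ are read as $0$.) Then, for $k=1,\dots,m$, $$\delta r_{n,k}=\frac{r_{n,k}^2}{R_{n,k}}-R_{n,k}\left(\frac{\big(n+\alpha+\sum_{j}r_{n,j}\big)\big(n+\sum_{j}r_{n,j}\big)}{1-\sum_{j}R_{n,j}}+\sum_{j}\frac{r_{n,j}^2}{R_{n,j}}\right),$$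 and $$\begin{aligned}&\delta^2R_{n,k}+\Big(t_k-\sum_{j\ne k}t_jR_{n,j}-2t_kR_{n,k}-2n-\alpha\Big)\delta R_{n,k}-R_{n,k}\sum_{j\neq k}t_j\,\delta R_{n,j}\\&=\left(\frac{\big(2(n+\alpha)+\sum_{j}2r_{n,j}\big)\big(2n+\sum_{j}2r_{n,j}\big)}{2\big(\sum_{j}R_{n,j}-1\big)}-\sum_{j}\frac{(2r_{n,j})^2}{2R_{n,j}}+\sum_{j}t_jR_{n,j}-t_k\right)R_{n,k}+\frac{(2r_{n,k})^2}{2R_{n,k}},\end{aligned}$$ where all sums run over $j=1,\dots,m$ (with $j\ne k$ where indicated), in the last equation $2r_{n,j}$ stands for $\delta R_{n,j}-\big(\sum_{i=1}^m t_iR_{n,i}-t_j+2n+\alpha\big)R_{n,j}$, and $$\delta^2=\sum_{k=1}^m t_k^2\partial^2_{t_kt_k}+2\sum_{1\le j<k\le m}t_jt_k\partial^2_{t_jt_k}+\delta.$$ Moreover $$\sigma_n=\frac{\big(n+\alpha+\sum_{k}r_{n,k}\big)\big(n+\sum_{k}r_{n,k}\big)}{\sum_{k}R_{n,k}-1}-\sum_{k}\frac{r_{n,k}^2}{R_{n,k}}+\sum_{k}t_kr_{n,k}+n(n+\alpha).$$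 Independently of the non-vanishing assumption, $\delta(\delta R_{n,k})$ equals $\delta^2R_{n,k}$ as given by this formula. (3) Without any non-vanishing assumption, with $$\Delta_k=\Big(\sum_{j=1}^mt_j\,\partial^2_{t_kt_j}\sigma_n\Big)^2+4\big(\delta\sigma_n-\sigma_n+n(n+\alpha)\big)\big(\partial_{t_k}\sigma_n\big)^2,$$ we have $\Delta_k\ge0$ for $k=1,\dots,m$, and $$\begin{aligned}&\Big(\sum_{k=1}^m\mathrm{sgn}(\omega_k)\sqrt{\Delta_k}-2\big(\delta\sigma_n-\sigma_n+n(n+\alpha)\big)\Big)^2-\Big(\sum_{k=1}^m\sum_{j=1}^mt_j\,\partial^2_{t_kt_j}\sigma_n\Big)^2\\&=4\big(\delta\sigma_n-\sigma_n+n(n+\alpha)\big)\Big(n+\alpha+\sum_{k=1}^m\partial_{t_k}\sigma_n\Big)\Big(n+\sum_{k=1}^m\partial_{t_k}\sigma_n\Big).\end{aligned}$$ -/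

import Mathlib

namespace LaguerreJump

noncomputable section

/-- The step function: `1` for `x > 0` and `0` otherwise. -/
def theta (x : ℝ) : ℝ := if 0 < x then 1 else 0

/-- The classical Laguerre weight `x ^ α * exp (-x)`. -/
def w0 (α x : ℝ) : ℝ := x ^ α * Real.exp (-x)

/-- The Laguerre weight with jumps at `t 0 < ⋯ < t (m - 1)`. The entry `ω 0` is the constant term
and `ω k.succ` is the size of the jump at `t k`. -/
def weight (α : ℝ) {m : ℕ} (ω : Fin (m + 1) → ℝ) (t : Fin m → ℝ) (x : ℝ) : ℝ :=
  w0 α x * (ω 0 + ∑ k : Fin m, ω k.succ * theta (x - t k))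

/-- The bilinear form `∫₀^∞ p q w dx` on real polynomials. -/
def pairing (α : ℝ) {m : ℕ} (ω : Fin (m + 1) → ℝ) (t : Fin m → ℝ) (p q : Polynomial ℝ) : ℝ :=
  ∫ x in Set.Ioi (0 : ℝ), p.eval x * q.eval x * weight α ω t x

/-- The monic orthogonal polynomials `P_n(·; t)` of the weight, obtained by orthogonalizing
`1, X, X ^ 2, …`. -/
def P (α : ℝ) {m : ℕ} (ω : Fin (m + 1) → ℝ) (t : Fin m → ℝ) (n : ℕ) : Polynomial ℝ :=
  Polynomial.X ^ n - ∑ j : Fin n,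
    Polynomial.C (pairing α ω t (Polynomial.X ^ n) (P α ω t j) /
      pairing α ω t (P α ω t j) (P α ω t j)) * P α ω t j
termination_by n
decreasing_by all_goals exact j.isLt

/-- The squared norm `h_n = ∫₀^∞ P_n ^ 2 w dx`. -/
def h (α : ℝ) {m : ℕ} (ω : Fin (m + 1) → ℝ) (n : ℕ) (t : Fin m → ℝ) : ℝ :=
  pairing α ω t (P α ω t n) (P α ω t n)

/-- The auxiliary quantity `R_{n,k}`. -/
def R (α : ℝ) {m : ℕ} (ω : Fin (m + 1) → ℝ) (n : ℕ) (k : Fin m) (t : Fin m → ℝ) : ℝ :=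
  ω k.succ * (w0 α (t k) / h α ω n t) * ((P α ω t n).eval (t k)) ^ 2

/-- The auxiliary quantity `r_{n,k}`, with `r_{0,k} = 0`. -/
def r (α : ℝ) {m : ℕ} (ω : Fin (m + 1) → ℝ) : ℕ → Fin m → (Fin m → ℝ) → ℝ
  | 0, _, _ => 0
  | n + 1, k, t => ω k.succ * (w0 α (t k) / h α ω n t) *
      (P α ω t (n + 1)).eval (t k) * (P α ω t n).eval (t k)

/-- The Hankel determinant `D_n` of the moments of the weight. -/
def hankel (α : ℝ) {m : ℕ} (ω : Fin (m + 1) → ℝ) (n : ℕ) (t : Fin m → ℝ) : ℝ :=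
  Matrix.det (Matrix.of fun i j : Fin n =>
    ∫ x in Set.Ioi (0 : ℝ), x ^ ((i : ℕ) + (j : ℕ)) * weight α ω t x)

/-- The partial derivative `∂f/∂t_k`. -/
def pd {m : ℕ} (k : Fin m) (f : (Fin m → ℝ) → ℝ) (t : Fin m → ℝ) : ℝ :=
  lineDeriv ℝ f t (Pi.single k 1)

/-- The operator `δ = ∑ t_k ∂_{t_k}`. -/
def delta {m : ℕ} (f : (Fin m → ℝ) → ℝ) (t : Fin m → ℝ) : ℝ :=
  ∑ k : Fin m, t k * pd k f t

/-- The operator `∑ t_k² ∂²_{t_k t_k} + 2 ∑_{j<k} t_j t_k ∂²_{t_j t_k} + δ`. -/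
def delta2 {m : ℕ} (f : (Fin m → ℝ) → ℝ) (t : Fin m → ℝ) : ℝ :=
  (∑ k : Fin m, t k ^ 2 * pd k (pd k f) t) +
    2 * (∑ k : Fin m, ∑ j ∈ Finset.Iio k, t j * t k * pd j (pd k f) t) + delta f t

/-- `σ_n = δ ln D_n`. -/
def sigma (α : ℝ) {m : ℕ} (ω : Fin (m + 1) → ℝ) (n : ℕ) : (Fin m → ℝ) → ℝ :=
  delta fun t => Real.log (hankel α ω n t)

/-- The expression in the `R_{n,j}` and their first derivatives that stands for `2 r_{n,k}` in the
second order system for the `R_{n,j}`. -/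
def twoR (α : ℝ) {m : ℕ} (ω : Fin (m + 1) → ℝ) (n : ℕ) (k : Fin m) (t : Fin m → ℝ) : ℝ :=
  delta (R α ω n k) t - (∑ j, t j * R α ω n j t - t k + 2 * n + α) * R α ω n k t

/-- The expression `δσ_n - σ_n + n (n + α)`. -/
def betaExpr (α : ℝ) {m : ℕ} (ω : Fin (m + 1) → ℝ) (n : ℕ) (t : Fin m → ℝ) : ℝ :=
  delta (sigma α ω n) t - sigma α ω n t + n * (n + α)

/-- The expression `∑_j t_j ∂²_{t_k t_j} σ_n`. -/
def mixed (α : ℝ) {m : ℕ} (ω : Fin (m + 1) → ℝ) (n : ℕ) (k : Fin m) (t : Fin m → ℝ) : ℝ :=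
  ∑ j : Fin m, t j * pd k (pd j (sigma α ω n)) t

/-- The quantity `Δ_k`. -/
def Delta (α : ℝ) {m : ℕ} (ω : Fin (m + 1) → ℝ) (n : ℕ) (k : Fin m) (t : Fin m → ℝ) : ℝ :=
  mixed α ω n k t ^ 2 + 4 * betaExpr α ω n t * pd k (sigma α ω n) t ^ 2

end

end LaguerreJump

namespace LaguerreJump

open MeasureTheory Set Filter Polynomial
open scoped Topology

noncomputable section

/-! Integration against the weight acts on polynomials as a linear functional `mu`, and two facts
about it drive everything. Along a direction v, the derivative of `mu` on a fixed p is -∑ v_k ω_k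
w₀(t_k) p(t_k), because only the jumps move. The Pearson equation x w₀' = (α - x) w₀, integrated by
parts, expresses `mu` of x p' + (α + 1 - x) p as -∑ t_k ω_k w₀(t_k) p(t_k). For v = t, the direction
of δ, the two boundary sums coincide and cancel. Orthogonality then forces δP_n + x P_n' to be an
explicit combination of P_n and one neighbour (`dP_add_X_mul_derivative` and its primed variant).

Evaluated at t_k, δP_n + x P_n' is the derivative of P_n(t_k) under dilation of t. With β_n = h_n /
h_{n-1} for n ≥ 1, this gives the equation for δR_{n,k} and also δr_{n,k} = β_n (R_{n-1,k} -
R_{n,k}), while r_{n,k}² = β_n R_{n-1,k} R_{n,k} is immediate. Telescoping δ ln h_j shows that σ_n -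
n(n + α) is the subleading coefficient of P_n, whence ∂_k σ_n = r_{n,k} and δσ_n - σ_n + n(n + α) =
β_n.

The last ingredient, `quadratic_relation_succ`, comes from the Pearson relation applied to a
Christoffel–Darboux kernel at the origin: β_n (1 - ∑R_{n-1,k})(1 - ∑R_{n,k}) = (n + α + ∑r_{n,k})(n
+ ∑r_{n,k}). What remains is to eliminate R_{n-1,k}. Dividing by R_{n,k} gives the coupled system.
Without division, Δ_k = β_n² (R_{n-1,k} + R_{n,k})², whose root carries the sign of ω_k, and this
gives the σ-form. -/

/-- The open set of admissible positions of the jumps. -/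
def chamber (m : ℕ) : Set (Fin m → ℝ) := {t | (∀ k, 0 < t k) ∧ StrictMono t}

theorem isOpen_chamber (m : ℕ) : IsOpen (chamber m) := by
  have h : chamber m = (⋂ k, {t | 0 < t k}) ∩ ⋂ i, ⋂ j, {t | i < j → t i < t j} := by
    ext t
    simp only [chamber, StrictMono, mem_ofPred_eq, mem_inter_iff, mem_iInter]
  rw [h]
  refine (isOpen_iInter_of_finite fun k => isOpen_lt continuous_const (continuous_apply k)).inter
    (isOpen_iInter_of_finite fun i => isOpen_iInter_of_finite fun j => ?_)
  by_cases hij : i < j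
  · simpa [hij] using isOpen_lt (continuous_apply i) (continuous_apply j)
  · simp [hij]

/-! ### Tail moments of the classical Laguerre weight -/

/-- The tail moments `∫ₛ^∞ x ^ i w₀ dx`. -/
def tail (α : ℝ) (i : ℕ) (s : ℝ) : ℝ := ∫ x in Ioi s, x ^ i * w0 α x

theorem pow_mul_w0 (α : ℝ) (i : ℕ) {x : ℝ} (hx : 0 < x) :
    x ^ i * w0 α x = Real.exp (-x) * x ^ (α + i) := by
  rw [w0, Real.rpow_add hx, Real.rpow_natCast]; ring

theorem integrableOn_pow_mul_w0 {α : ℝ} (hα : -1 < α) (i : ℕ) :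
    IntegrableOn (fun x => x ^ i * w0 α x) (Ioi 0) := by
  have h := Real.GammaIntegral_convergent (s := α + i + 1)
    (by have : (0 : ℝ) ≤ i := i.cast_nonneg; linarith)
  refine h.congr_fun (fun x hx => ?_) measurableSet_Ioi
  simp only [add_sub_cancel_right]
  exact (pow_mul_w0 α i hx).symm

theorem contDiffAt_w0 (α : ℝ) {s : ℝ} (hs : 0 < s) {n : WithTop ℕ∞} :
    ContDiffAt ℝ n (w0 α) s := by
  unfold w0
  exact (Real.contDiffAt_rpow_const_of_ne hs.ne').mul
    (Real.contDiff_exp.contDiffAt.comp s contDiffAt_id.neg)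

theorem hasDerivAt_w0 (α : ℝ) {s : ℝ} (hs : 0 < s) :
    HasDerivAt (w0 α) ((α / s - 1) * w0 α s) s := by
  have h1 := (Real.hasDerivAt_rpow_const (p := α) (Or.inl hs.ne')).mul
    ((hasDerivAt_id s).neg.exp)
  refine h1.congr_deriv ?_
  simp only [w0, id, Pi.neg_apply]
  rw [Real.rpow_sub_one hs.ne']
  field_simp
  ring

theorem hasDerivAt_tail {α : ℝ} (hα : -1 < α) (i : ℕ) {s : ℝ} (hs : 0 < s) :
    HasDerivAt (tail α i) (-(s ^ i * w0 α s)) s := by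
  have hint := integrableOn_pow_mul_w0 hα i
  have hcont : ∀ x, 0 < x → ContinuousAt (fun x => x ^ i * w0 α x) x := fun x hx =>
    (continuousAt_id.pow i).mul (contDiffAt_w0 α hx (n := 0)).continuousAt
  have hd : HasDerivAt (fun u => ∫ x in (0 : ℝ)..u, x ^ i * w0 α x) (s ^ i * w0 α s) s := by
    refine intervalIntegral.integral_hasDerivAt_right
      ((intervalIntegrable_iff_integrableOn_Ioc_of_le hs.le).2 (hint.mono_set Ioc_subset_Ioi_self))
      ?_ (hcont s hs)
    exact ContinuousAt.stronglyMeasurableAtFilter isOpen_Ioi (fun x hx => hcont x hx) s hs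
  have heq : tail α i =ᶠ[𝓝 s] fun u => tail α i 0 - ∫ x in (0 : ℝ)..u, x ^ i * w0 α x := by
    filter_upwards [lt_mem_nhds hs] with u hu
    have := intervalIntegral.integral_interval_add_Ioi (a := 0) (b := u)
      hint (hint.mono_set (Ioi_subset_Ioi hu.le))
    simp only [tail]
    linarith
  exact (hd.const_sub _).congr_of_eventuallyEq heq

/-- The first derivative is an explicit function that is smooth on the open half-line, so one
differentiation suffices. -/
theorem contDiffAt_tail {α : ℝ} (hα : -1 < α) (i : ℕ) {s : ℝ} (hs : 0 < s) :
    ContDiffAt ℝ ((⊤ : ℕ∞) : WithTop ℕ∞) (tail α i) s := by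
  have h : ContDiffOn ℝ ((⊤ : ℕ∞) : WithTop ℕ∞) (tail α i) (Ioi 0) := by
    rw [contDiffOn_infty_iff_deriv_of_isOpen isOpen_Ioi]
    refine ⟨fun x hx => (hasDerivAt_tail hα i hx).differentiableAt.differentiableWithinAt, ?_⟩
    refine ContDiffOn.congr (f := fun x => -(x ^ i * w0 α x)) (fun x hx => ?_)
      (fun x hx => (hasDerivAt_tail hα i hx).deriv)
    exact ((contDiffAt_id.pow i).mul (contDiffAt_w0 α hx)).neg.contDiffWithinAt
  exact h.contDiffAt (Ioi_mem_nhds hs)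

/-- Integrate the derivative of x^(α+1+i) e^(-x) over (s, ∞). The case s = 0 is included for the
constant part of the weight; there the boundary term vanishes because α + 1 + i > 0. -/
theorem tail_pearson {α : ℝ} (hα : -1 < α) (i : ℕ) {s : ℝ} (hs : 0 ≤ s) :
    (α + 1 + i) * tail α i s - tail α (i + 1) s = -(s * (s ^ i * w0 α s)) := by
  have hi : (0 : ℝ) ≤ i := i.cast_nonneg
  have hI : ∀ i, IntegrableOn (fun x => x ^ i * w0 α x) (Ioi s) := fun i =>
    (integrableOn_pow_mul_w0 hα i).mono_set (Ioi_subset_Ioi hs)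
  have hpos : 0 < α + 1 + i := by linarith
  have hint : IntegrableOn (fun x => (α + 1 + i) * (x ^ i * w0 α x) - x ^ (i + 1) * w0 α x)
      (Ioi s) := ((hI i).const_mul _).sub (hI (i + 1))
  have hd : ∀ x ∈ Ioi s, HasDerivAt (fun x : ℝ => x ^ (α + 1 + i) * Real.exp (-x))
      ((α + 1 + i) * (x ^ i * w0 α x) - x ^ (i + 1) * w0 α x) x := by
    intro x hx
    have hx0 : 0 < x := hs.trans_lt hx
    have h1 := (Real.hasDerivAt_rpow_const (p := α + 1 + i) (Or.inl hx0.ne')).mul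
      ((hasDerivAt_id x).neg.exp)
    refine h1.congr_deriv ?_
    rw [pow_mul_w0 α i hx0, pow_mul_w0 α (i + 1) hx0]
    simp only [id, Pi.neg_apply]
    push_cast
    rw [show α + 1 + i - 1 = α + i by ring, show α + (i + 1 : ℝ) = α + 1 + i by ring]
    ring
  have hc : ContinuousWithinAt (fun x : ℝ => x ^ (α + 1 + i) * Real.exp (-x)) (Ici s) s :=
    ((Real.continuousAt_rpow_const _ _ (Or.inr hpos.le)).mul
      (Real.continuous_exp.comp continuous_neg).continuousAt).continuousWithinAt
  have ht : Tendsto (fun x : ℝ => x ^ (α + 1 + i) * Real.exp (-x)) atTop (𝓝 0) := by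
    simpa using tendsto_rpow_mul_exp_neg_mul_atTop_nhds_zero (α + 1 + i) 1 one_pos
  have key := integral_Ioi_of_hasDerivAt_of_tendsto hc hd hint ht
  rw [integral_sub ((hI i).const_mul _) (hI (i + 1)), integral_const_mul] at key
  simp only [tail]
  rw [key, zero_sub]
  congr 1
  rcases hs.eq_or_lt with rfl | hs0
  · simp [Real.zero_rpow hpos.ne']
  · rw [pow_mul_w0 α i hs0, show α + 1 + i = α + i + 1 by ring, Real.rpow_add_one hs0.ne']
    ring

/-! ### The moment functional and its Pearson relation -/

/-- The moments of the weight, written through tail moments. -/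
def mom (α : ℝ) {m : ℕ} (ω : Fin (m + 1) → ℝ) (i : ℕ) (t : Fin m → ℝ) : ℝ :=
  ω 0 * tail α i 0 + ∑ k : Fin m, ω k.succ * tail α i (t k)

/-- The moment functional of the weight. -/
def mu (α : ℝ) {m : ℕ} (ω : Fin (m + 1) → ℝ) (t : Fin m → ℝ) : ℝ[X] →ₗ[ℝ] ℝ :=
  Polynomial.lsum fun i => mom α ω i t • LinearMap.id

variable {α : ℝ} {m : ℕ} {ω : Fin (m + 1) → ℝ} {t : Fin m → ℝ}

theorem mu_eq_sum {p : ℝ[X]} {N : ℕ} (hp : p.natDegree ≤ N) :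
    mu α ω t p = ∑ i ∈ Finset.range (N + 1), p.coeff i * mom α ω i t := by
  rw [mu, Polynomial.lsum_apply, Polynomial.sum_over_range' _ _ (N + 1) (Nat.lt_succ_of_le hp)]
  · simp [mul_comm]
  · simp

theorem mu_X_pow (i : ℕ) : mu α ω t (X ^ i) = mom α ω i t := by
  rw [mu_eq_sum (natDegree_X_pow_le i)]
  simp [coeff_X_pow]

theorem integrableOn_pow_mul_theta (hα : -1 < α) (i : ℕ) (s : ℝ) :
    IntegrableOn (fun x => x ^ i * w0 α x * theta (x - s)) (Ioi 0) := by
  have : (fun x => x ^ i * w0 α x * theta (x - s)) =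
      (Ioi s).indicator fun x => x ^ i * w0 α x := by
    ext x; simp [theta, indicator]
  rw [this]
  exact (integrableOn_pow_mul_w0 hα i).indicator measurableSet_Ioi

theorem integral_pow_mul_theta (i : ℕ) {s : ℝ} (hs : 0 ≤ s) :
    ∫ x in Ioi (0 : ℝ), x ^ i * w0 α x * theta (x - s) = tail α i s := by
  have : (fun x => x ^ i * w0 α x * theta (x - s)) =
      (Ioi s).indicator fun x => x ^ i * w0 α x := by
    ext x; simp [theta, indicator]
  rw [this, setIntegral_indicator measurableSet_Ioi,
    inter_eq_right.2 (Ioi_subset_Ioi hs), tail]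

theorem pow_mul_weight (i : ℕ) (x : ℝ) : x ^ i * weight α ω t x =
    ω 0 * (x ^ i * w0 α x) + ∑ k : Fin m, ω k.succ * (x ^ i * w0 α x * theta (x - t k)) := by
  rw [weight, mul_add, mul_add, Finset.mul_sum, Finset.mul_sum]
  congr 1
  · ring
  · exact Finset.sum_congr rfl fun k _ => by ring

theorem integrableOn_pow_mul_weight (hα : -1 < α) (i : ℕ) :
    IntegrableOn (fun x => x ^ i * weight α ω t x) (Ioi 0) := by
  simp only [pow_mul_weight]
  exact ((integrableOn_pow_mul_w0 hα i).const_mul _).add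
    (integrable_finsetSum _ fun k _ => (integrableOn_pow_mul_theta hα i _).const_mul _)

theorem integral_pow_mul_weight (hα : -1 < α) (ht : ∀ k, 0 < t k) (i : ℕ) :
    ∫ x in Ioi (0 : ℝ), x ^ i * weight α ω t x = mom α ω i t := by
  simp only [pow_mul_weight]
  have h1 : ∀ k ∈ (Finset.univ : Finset (Fin m)), Integrable
      (fun x => ω k.succ * (x ^ i * w0 α x * theta (x - t k))) (volume.restrict (Ioi 0)) :=
    fun k _ => (integrableOn_pow_mul_theta hα i _).const_mul _
  rw [integral_add ((integrableOn_pow_mul_w0 hα i).const_mul _) (integrable_finsetSum _ h1),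
    integral_finsetSum _ h1, integral_const_mul, mom, tail]
  congr 1
  exact Finset.sum_congr rfl fun k _ => by
    rw [integral_const_mul, integral_pow_mul_theta i (ht k).le]

theorem integrableOn_eval_mul_weight (hα : -1 < α) (p : ℝ[X]) :
    IntegrableOn (fun x => p.eval x * weight α ω t x) (Ioi 0) := by
  simp only [eval_eq_sum_range, Finset.sum_mul, mul_assoc]
  exact integrable_finsetSum _ fun i _ => (integrableOn_pow_mul_weight hα i).const_mul _

theorem integral_eval_mul_weight (hα : -1 < α) (ht : ∀ k, 0 < t k) (p : ℝ[X]) :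
    ∫ x in Ioi (0 : ℝ), p.eval x * weight α ω t x = mu α ω t p := by
  simp only [eval_eq_sum_range, Finset.sum_mul, mul_assoc]
  rw [integral_finsetSum _ fun i _ => (integrableOn_pow_mul_weight hα i).const_mul _,
    mu_eq_sum le_rfl]
  exact Finset.sum_congr rfl fun i _ => by
    rw [integral_const_mul, integral_pow_mul_weight hα ht]

theorem pairing_eq_mu (hα : -1 < α) (ht : ∀ k, 0 < t k) (p q : ℝ[X]) :
    pairing α ω t p q = mu α ω t (p * q) := by
  simp only [pairing, ← integral_eval_mul_weight hα ht, eval_mul]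

/-- The Pearson relation of the weight with jumps. -/
theorem mu_pearson (hα : -1 < α) (ht : ∀ k, 0 < t k) (p : ℝ[X]) :
    mu α ω t (X * derivative p + (C (α + 1) - X) * p) =
      -∑ k : Fin m, t k * (ω k.succ * w0 α (t k)) * p.eval (t k) := by
  induction p using Polynomial.induction_on' with
  | add p q hp hq =>
    rw [derivative_add, show X * (derivative p + derivative q) + (C (α + 1) - X) * (p + q) =
      (X * derivative p + (C (α + 1) - X) * p) + (X * derivative q + (C (α + 1) - X) * q) by ring,
      map_add, hp, hq, ← neg_add, ← Finset.sum_add_distrib]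
    simp only [eval_add, mul_add]
  | monomial i a =>
    have h : X * derivative (monomial i a) + (C (α + 1) - X) * monomial i a =
        (a * (α + 1 + i)) • X ^ i - a • (X ^ (i + 1) : ℝ[X]) := by
      simp only [← C_mul_X_pow_eq_monomial, derivative_C_mul_X_pow, smul_eq_C_mul]
      rcases i with _ | i
      · simp; ring
      · simp; ring
    rw [h, map_sub, map_smul, map_smul, mu_X_pow, mu_X_pow, smul_eq_mul, smul_eq_mul]
    have key : (α + 1 + i) * mom α ω i t - mom α ω (i + 1) t =
        -∑ k : Fin m, t k * (ω k.succ * w0 α (t k)) * t k ^ i := by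
      simp only [mom]
      have h0 := tail_pearson hα i le_rfl
      rw [zero_mul, neg_zero] at h0
      rw [show (α + 1 + i) * (ω 0 * tail α i 0 + ∑ k : Fin m, ω k.succ * tail α i (t k)) -
        (ω 0 * tail α (i + 1) 0 + ∑ k : Fin m, ω k.succ * tail α (i + 1) (t k)) =
        ω 0 * ((α + 1 + i) * tail α i 0 - tail α (i + 1) 0) +
        ((α + 1 + i) * (∑ k : Fin m, ω k.succ * tail α i (t k)) -
          ∑ k : Fin m, ω k.succ * tail α (i + 1) (t k)) by ring, h0, mul_zero, zero_add,
        Finset.mul_sum, ← Finset.sum_sub_distrib, ← Finset.sum_neg_distrib]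
      refine Finset.sum_congr rfl fun k _ => ?_
      linear_combination ω k.succ * tail_pearson hα i (ht k).le
    simp only [eval_monomial]
    rw [show a * (α + 1 + i) * mom α ω i t - a * mom α ω (i + 1) t =
      a * ((α + 1 + i) * mom α ω i t - mom α ω (i + 1) t) by ring, key, mul_neg, Finset.mul_sum]
    congr 1
    exact Finset.sum_congr rfl fun k _ => by ring

/-! ### Positivity -/

/-- The index l counts the jumps to the left of x, so the step factor is one of the partial sums
assumed nonnegative. -/
theorem step_eq_sum_Iic {x : ℝ} {l : Fin (m + 1)} (hl : ∀ k, t k < x ↔ k.castSucc < l) :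
    ω 0 + ∑ k : Fin m, ω k.succ * theta (x - t k) = ∑ k ∈ Finset.Iic l, ω k := by
  have : ∑ k ∈ Finset.Iic l, ω k = ∑ k, if k ≤ l then ω k else 0 := by
    rw [← Finset.sum_filter]
    congr 1
    ext; simp
  rw [this, Fin.sum_univ_succ]
  simp only [Fin.zero_le, if_true]
  congr 1
  refine Finset.sum_congr rfl fun k _ => ?_
  have : k.succ ≤ l ↔ t k < x := by
    rw [hl, Fin.lt_def, Fin.le_def, Fin.val_succ, Fin.val_castSucc]; omega
  simp [theta, this]

theorem exists_jump_index (ht : StrictMono t) (x : ℝ) :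
    ∃ l : Fin (m + 1), ∀ k, t k < x ↔ k.castSucc < l := by
  classical
  let S : Finset (Fin (m + 1)) := {l | ∀ k : Fin m, k.castSucc < l → t k < x}
  have hS : S.Nonempty := ⟨0, by simp [S]⟩
  have hmax := S.max'_mem hS
  refine ⟨S.max' hS, fun k => ⟨fun hk => ?_, fun hk => ?_⟩⟩
  · have : k.succ ∈ S := by
      simp only [S, Finset.mem_filter, Finset.mem_univ, true_and]
      intro j hj
      refine (ht.monotone ?_).trans_lt hk
      rw [Fin.lt_def, Fin.val_castSucc, Fin.val_succ] at hj
      rw [Fin.le_def]; omega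
    exact lt_of_lt_of_le Fin.castSucc_lt_succ (S.le_max' _ this)
  · simp only [S, Finset.mem_filter, Finset.mem_univ, true_and] at hmax
    exact hmax k hk

theorem exists_interval_jump_index (ht : t ∈ chamber m) (l : Fin (m + 1)) :
    ∃ a b : ℝ, 0 ≤ a ∧ a < b ∧ ∀ x ∈ Ioo a b, ∀ k, t k < x ↔ k.castSucc < l := by
  obtain ⟨hpos, hmono⟩ := ht
  have hA : ∃ a : ℝ, 0 ≤ a ∧ (∀ k : Fin m, k.castSucc < l → t k ≤ a) ∧
      ∀ k : Fin m, l ≤ k.castSucc → a < t k := by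
    refine Fin.cases ⟨0, le_rfl, ?_, fun k _ => hpos k⟩ (fun i => ?_) l
    · intro k hk; simp at hk
    · refine ⟨t i, (hpos i).le, fun k hk => hmono.monotone ?_, fun k hk => hmono ?_⟩
      · rw [Fin.lt_def, Fin.val_castSucc, Fin.val_succ] at hk
        rw [Fin.le_def]; omega
      · rw [Fin.le_def, Fin.val_castSucc, Fin.val_succ] at hk
        rw [Fin.lt_def]; omega
  obtain ⟨a, ha0, ha1, ha2⟩ := hA
  have hB : ∃ b : ℝ, a < b ∧ ∀ k : Fin m, l ≤ k.castSucc → b ≤ t k := by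
    revert ha1 ha2
    -- To the right of the last jump the interval is unbounded, and any right endpoint serves;
    -- otherwise the next jump is taken.
    refine Fin.lastCases (fun _ _ => ⟨a + 1, by linarith, ?_⟩) (fun i _ ha2 => ?_) l
    · intro k hk; exact absurd hk (not_le.2 (Fin.castSucc_lt_last k))
    · exact ⟨t i, ha2 i le_rfl, fun k hk => hmono.monotone hk⟩
  obtain ⟨b, hab, hb⟩ := hB
  refine ⟨a, b, ha0, hab, fun x hx k => ⟨fun hk => ?_, fun hk => (ha1 k hk).trans_lt hx.1⟩⟩
  by_contra hcon
  exact absurd (hk.trans hx.2) (not_lt.2 (hb k (not_lt.1 hcon)))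

theorem w0_pos (α : ℝ) {x : ℝ} (hx : 0 < x) : 0 < w0 α x :=
  mul_pos (Real.rpow_pos_of_pos hx _) (Real.exp_pos _)

/-- The hypotheses on the parameters of the weight. -/
structure Admissible (α : ℝ) {m : ℕ} (ω : Fin (m + 1) → ℝ) : Prop where
  neg_one_lt : -1 < α
  sum_nonneg : ∀ l : Fin (m + 1), 0 ≤ ∑ k ∈ Finset.Iic l, ω k
  ne_zero : ω ≠ 0

/-- If all partial sums vanished, so would their successive differences, which are the ω's. -/
theorem Admissible.exists_sum_pos (hA : Admissible α ω) :
    ∃ l : Fin (m + 1), 0 < ∑ k ∈ Finset.Iic l, ω k := by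
  by_contra! hcon
  have h0 : ∀ l : Fin (m + 1), ∑ k ∈ Finset.Iic l, ω k = 0 := fun l =>
    le_antisymm (hcon l) (hA.sum_nonneg l)
  apply hA.ne_zero
  ext l
  refine Fin.cases ?_ (fun i => ?_) l
  · have h := h0 0
    rwa [show Finset.Iic (0 : Fin (m + 1)) = {0} by ext j; simp, Finset.sum_singleton] at h
  · have h := h0 i.succ
    have hins : Finset.Iic i.succ = insert i.succ (Finset.Iic i.castSucc) := by
      ext j
      simp only [Finset.mem_Iic, Finset.mem_insert, Fin.le_def, Fin.ext_iff, Fin.val_succ,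
        Fin.val_castSucc]
      omega
    rw [hins, Finset.sum_insert (by simp), h0, add_zero] at h
    exact h

theorem Admissible.weight_nonneg (hA : Admissible α ω) (ht : StrictMono t) {x : ℝ} (hx : 0 < x) :
    0 ≤ weight α ω t x := by
  obtain ⟨l, hl⟩ := exists_jump_index ht x
  rw [weight, step_eq_sum_Iic hl]
  exact mul_nonneg (w0_pos α hx).le (hA.sum_nonneg l)

/-- The integrand is nonnegative, and on an interval between jumps where the partial sum is positive
it vanishes only at the finitely many roots of p. -/
theorem Admissible.mu_pos (hA : Admissible α ω) (ht : t ∈ chamber m) {p : ℝ[X]}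
    (hp : ∀ x, 0 < x → 0 ≤ p.eval x) (hp0 : p ≠ 0) : 0 < mu α ω t p := by
  rw [← integral_eval_mul_weight hA.neg_one_lt ht.1]
  have hnn : 0 ≤ᵐ[volume.restrict (Ioi 0)] fun x => p.eval x * weight α ω t x :=
    (ae_restrict_iff' measurableSet_Ioi).2 (Eventually.of_forall fun x hx =>
      mul_nonneg (hp x hx) (hA.weight_nonneg ht.2 hx))
  rw [setIntegral_pos_iff_support_of_nonneg_ae hnn
    (integrableOn_eval_mul_weight hA.neg_one_lt p)]
  obtain ⟨l, hl⟩ := hA.exists_sum_pos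
  obtain ⟨a, b, ha, hab, hx⟩ := exists_interval_jump_index ht l
  have hsub : Ioo a b \ (p.roots.toFinset : Set ℝ) ⊆
      Function.support (fun x => p.eval x * weight α ω t x) ∩ Ioi 0 := by
    rintro x ⟨hxab, hroot⟩
    have hx0 : 0 < x := ha.trans_lt hxab.1
    refine ⟨?_, hx0⟩
    rw [Function.mem_support, weight, step_eq_sum_Iic (hx x hxab)]
    refine mul_ne_zero (fun h => hroot ?_) (mul_pos (w0_pos α hx0) hl).ne'
    simpa [hp0] using h
  refine lt_of_lt_of_le ?_ (measure_mono hsub)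
  rw [measure_sdiff_null (Finset.measure_zero _ _)]
  simpa using hab

/-! ### Orthogonality -/

/-- Only the triangular shape of the recursion matters, so this holds for every t. The later
differentiation lemmas use such degree bounds uniformly in the parameter. -/
theorem P_monic_natDegree (α : ℝ) {m : ℕ} (ω : Fin (m + 1) → ℝ) (t : Fin m → ℝ) (n : ℕ) :
    (P α ω t n).Monic ∧ (P α ω t n).natDegree = n := by
  induction n using Nat.strong_induction_on with
  | _ n ih =>
    rw [P]
    set S := ∑ j : Fin n, C (pairing α ω t (X ^ n) (P α ω t j) /
      pairing α ω t (P α ω t j) (P α ω t j)) * P α ω t j with hS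
    have hdeg : S.degree < n := by
      rw [← mem_degreeLT, hS]
      refine Submodule.sum_mem _ fun j _ => ?_
      rw [← smul_eq_C_mul]
      refine Submodule.smul_mem _ _ (mem_degreeLT.2 ?_)
      rw [degree_eq_natDegree (ih j j.isLt).1.ne_zero, (ih j j.isLt).2]
      exact_mod_cast j.isLt
    have hX : S.degree < (X ^ n : ℝ[X]).degree := by rwa [degree_X_pow]
    refine ⟨(monic_X_pow n).sub_of_left hX, ?_⟩
    rw [natDegree_eq_of_degree_eq (degree_sub_eq_left_of_degree_lt hX), natDegree_X_pow]

theorem P_monic (α : ℝ) {m : ℕ} (ω : Fin (m + 1) → ℝ) (t : Fin m → ℝ) (n : ℕ) :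
    (P α ω t n).Monic := (P_monic_natDegree α ω t n).1

theorem natDegree_P (α : ℝ) {m : ℕ} (ω : Fin (m + 1) → ℝ) (t : Fin m → ℝ) (n : ℕ) :
    (P α ω t n).natDegree = n := (P_monic_natDegree α ω t n).2

theorem degree_P (α : ℝ) {m : ℕ} (ω : Fin (m + 1) → ℝ) (t : Fin m → ℝ) (n : ℕ) :
    (P α ω t n).degree = n := by
  rw [degree_eq_natDegree (P_monic α ω t n).ne_zero, natDegree_P]

theorem coeff_P_self (α : ℝ) {m : ℕ} (ω : Fin (m + 1) → ℝ) (t : Fin m → ℝ) (n : ℕ) :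
    (P α ω t n).coeff n = 1 := by
  simpa [natDegree_P] using (P_monic α ω t n).coeff_natDegree

theorem P_zero (α : ℝ) {m : ℕ} (ω : Fin (m + 1) → ℝ) (t : Fin m → ℝ) : P α ω t 0 = 1 := by
  rw [P]; simp

theorem degree_sub_C_coeff_mul_lt {p q : ℝ[X]} {d : ℕ} (hp : p.natDegree = d) (hm : p.Monic)
    (hq : q.degree < (d + 1 : ℕ)) : (q - C (q.coeff d) * p).degree < d := by
  rw [degree_lt_iff_coeff_zero] at hq ⊢
  intro i hi
  rw [coeff_sub, coeff_C_mul]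
  rcases hi.eq_or_lt with rfl | hi
  · have : p.coeff d = 1 := by simpa [hp] using hm.coeff_natDegree
    rw [this]; ring
  · rw [hq i hi, coeff_eq_zero_of_natDegree_lt (hp.trans_lt hi)]; ring

namespace Admissible

theorem mu_mul_self_pos (hA : Admissible α ω) (ht : t ∈ chamber m) {p : ℝ[X]} (hp : p ≠ 0) :
    0 < mu α ω t (p * p) :=
  hA.mu_pos ht (fun x _ => by rw [eval_mul]; exact mul_self_nonneg _) (mul_self_ne_zero.2 hp)

theorem h_eq (hA : Admissible α ω) (ht : t ∈ chamber m) (n : ℕ) :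
    h α ω n t = mu α ω t (P α ω t n * P α ω t n) := by
  rw [h, pairing_eq_mu hA.neg_one_lt ht.1]

theorem h_pos (hA : Admissible α ω) (ht : t ∈ chamber m) (n : ℕ) : 0 < h α ω n t := by
  rw [hA.h_eq ht]
  exact hA.mu_mul_self_pos ht (P_monic α ω t n).ne_zero

theorem mu_P_mul_P (hA : Admissible α ω) (ht : t ∈ chamber m) (n : ℕ) :
    ∀ j < n, mu α ω t (P α ω t n * P α ω t j) = 0 := by
  induction n using Nat.strong_induction_on with
  | _ n ih =>
    intro j hj
    have horth : ∀ i < n, i ≠ j → mu α ω t (P α ω t i * P α ω t j) = 0 := by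
      intro i hi hij
      rcases lt_or_gt_of_ne hij with h | h
      · rw [mul_comm]; exact ih j hj i h
      · exact ih i hi j h
    have hjj : mu α ω t (P α ω t j * P α ω t j) ≠ 0 :=
      (hA.mu_mul_self_pos ht (P_monic α ω t j).ne_zero).ne'
    rw [P, sub_mul, map_sub, Finset.sum_mul, map_sum]
    simp only [pairing_eq_mu hA.neg_one_lt ht.1, ← smul_eq_C_mul, smul_mul_assoc,
      map_smul, smul_eq_mul]
    rw [Finset.sum_eq_single (⟨j, hj⟩ : Fin n)]
    · simp only
      rw [div_mul_cancel₀ _ hjj, sub_self]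
    · intro i _ hi
      rw [horth i i.isLt (fun h => hi (Fin.ext h)), mul_zero]
    · simp

theorem mu_P_mul_of_degree_lt (hA : Admissible α ω) (ht : t ∈ chamber m) {n d : ℕ} (hd : d ≤ n)
    {q : ℝ[X]} (hq : q.degree < d) : mu α ω t (P α ω t n * q) = 0 := by
  induction d generalizing q with
  | zero =>
    have : q = 0 := by
      rw [← degree_eq_bot]
      simpa using hq
    simp [this]
  | succ d ih =>
    have h1 := ih (by omega) (degree_sub_C_coeff_mul_lt (natDegree_P α ω t d) (P_monic α ω t d) hq)
    rw [mul_sub, map_sub, mul_left_comm, ← smul_eq_C_mul, map_smul, hA.mu_P_mul_P ht n d hd,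
      smul_zero, sub_zero] at h1
    exact h1

/-- Subtracting the multiple of P_n that matches the top coefficient leaves a remainder orthogonal
to P_n. -/
theorem mu_P_mul (hA : Admissible α ω) (ht : t ∈ chamber m) {n : ℕ} {q : ℝ[X]}
    (hq : q.degree < (n + 1 : ℕ)) : mu α ω t (P α ω t n * q) = q.coeff n * h α ω n t := by
  have h1 := hA.mu_P_mul_of_degree_lt ht le_rfl
    (degree_sub_C_coeff_mul_lt (natDegree_P α ω t n) (P_monic α ω t n) hq)
  rw [mul_sub, map_sub, mul_left_comm, ← smul_eq_C_mul, map_smul, ← hA.h_eq ht, smul_eq_mul,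
    sub_eq_zero] at h1
  exact h1

theorem eq_zero_of_orthogonal (hA : Admissible α ω) (ht : t ∈ chamber m) {n : ℕ} {e : ℝ[X]}
    (he : e.degree < n) (horth : ∀ q : ℝ[X], q.degree < n → mu α ω t (e * q) = 0) : e = 0 := by
  by_contra hne
  exact (hA.mu_mul_self_pos ht hne).ne' (horth e he)

/-- If P_n = x q, then orthogonality to q would make the functional vanish on x q², which is
nonnegative on the half-line and nonzero. -/
theorem P_eval_zero_ne_zero (hA : Admissible α ω) (ht : t ∈ chamber m) (n : ℕ) :
    (P α ω t n).eval 0 ≠ 0 := by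
  intro h0
  obtain ⟨q, hq⟩ := X_dvd_iff.2 ((coeff_zero_eq_eval_zero _).trans h0)
  have hq0 : q ≠ 0 := by
    rintro rfl
    exact (P_monic α ω t n).ne_zero (by rw [hq, mul_zero])
  have hdeg : q.degree < n := by
    rw [← degree_P α ω t n, hq, mul_comm, degree_mul, degree_X, degree_eq_natDegree hq0]
    exact_mod_cast Nat.lt_succ_self _
  have h1 := hA.mu_P_mul_of_degree_lt ht le_rfl hdeg
  refine (hA.mu_pos ht (fun x hx => ?_) (mul_ne_zero (P_monic α ω t n).ne_zero hq0)).ne' h1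
  rw [hq, eval_mul, eval_mul, eval_X, mul_assoc]
  exact mul_nonneg hx.le (mul_self_nonneg _)

/-- The Hankel determinant is the product of the squared norms. -/
theorem hankel_eq_prod (hA : Admissible α ω) (ht : t ∈ chamber m) (n : ℕ) :
    hankel α ω n t = ∏ j ∈ Finset.range n, h α ω j t := by
  let A : Matrix (Fin n) (Fin n) ℝ := Matrix.of fun i j => (P α ω t i).coeff j
  let H : Matrix (Fin n) (Fin n) ℝ := Matrix.of fun i j => mom α ω (i + j) t
  have hH : hankel α ω n t = H.det := by
    simp only [hankel, integral_pow_mul_weight hA.neg_one_lt ht.1, H]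
  -- The coefficient matrix of the P_i is lower unitriangular, so conjugating the moment matrix to
  -- its diagonal form preserves the determinant.
  have hdet : A.det = 1 := by
    rw [Matrix.det_of_isLowerTriangular]
    · simp [A, coeff_P_self]
    · intro i j hij
      exact coeff_eq_zero_of_natDegree_lt (by rw [natDegree_P]; exact hij)
  have hdiag : A * H * A.transpose = Matrix.diagonal fun j : Fin n => h α ω j t := by
    ext i j
    have hsum : ∀ i : Fin n, P α ω t i = ∑ a : Fin n, (P α ω t i).coeff a • X ^ (a : ℕ) := by
      intro i
      conv_lhs => rw [as_sum_range_C_mul_X_pow' (P α ω t i) (n := n) (by rw [natDegree_P]; exact i.2)]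
      rw [Finset.sum_range]
      simp only [smul_eq_C_mul]
    have : (A * H * A.transpose) i j = mu α ω t (P α ω t i * P α ω t j) := by
      rw [hsum i, hsum j, Finset.sum_mul_sum, map_sum]
      simp only [map_sum, smul_mul_smul_comm, ← pow_add, map_smul, mu_X_pow, smul_eq_mul,
        Matrix.mul_apply, A, H, Matrix.transpose_apply, Matrix.of_apply, Finset.sum_mul]
      rw [Finset.sum_comm]
      exact Finset.sum_congr rfl fun a _ => Finset.sum_congr rfl fun b _ => by ring
    rw [this, Matrix.diagonal_apply]
    split_ifs with hij
    · rw [hij, hA.h_eq ht]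
    · rcases lt_or_gt_of_ne (fun h => hij (Fin.ext h) : (i : ℕ) ≠ j) with h | h
      · rw [mul_comm]; exact hA.mu_P_mul_P ht _ _ h
      · exact hA.mu_P_mul_P ht _ _ h
  have := congrArg Matrix.det hdiag
  rw [Matrix.det_mul, Matrix.det_mul, Matrix.det_transpose, hdet, one_mul, mul_one,
    Matrix.det_diagonal] at this
  rw [hH, this, Finset.prod_range]

end Admissible

/-! ### Smoothness and derivatives along lines -/

theorem eventually_mem_chamber (ht : t ∈ chamber m) : ∀ᶠ s in 𝓝 t, s ∈ chamber m :=
  (isOpen_chamber m).mem_nhds ht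

theorem contDiffAt_mom (hα : -1 < α) (ht : ∀ k, 0 < t k) (i : ℕ) :
    ContDiffAt ℝ ((⊤ : ℕ∞) : WithTop ℕ∞) (mom α ω i) t :=
  contDiffAt_const.add (ContDiffAt.sum fun k _ => contDiffAt_const.mul
    ((contDiffAt_tail hα i (ht k)).comp t (contDiff_apply ℝ ℝ k).contDiffAt))

theorem contDiffAt_mu (hα : -1 < α) (ht : ∀ k, 0 < t k) {p : (Fin m → ℝ) → ℝ[X]} {N : ℕ}
    (hN : ∀ s, (p s).natDegree ≤ N)
    (hp : ∀ i, ContDiffAt ℝ ((⊤ : ℕ∞) : WithTop ℕ∞) (fun s => (p s).coeff i) t) :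
    ContDiffAt ℝ ((⊤ : ℕ∞) : WithTop ℕ∞) (fun s => mu α ω s (p s)) t := by
  simp only [fun s => mu_eq_sum (α := α) (ω := ω) (t := s) (hN s)]
  exact ContDiffAt.sum fun i _ => (hp i).mul (contDiffAt_mom hα ht i)

theorem contDiffAt_coeff_mul {p q : (Fin m → ℝ) → ℝ[X]}
    (hp : ∀ i, ContDiffAt ℝ ((⊤ : ℕ∞) : WithTop ℕ∞) (fun s => (p s).coeff i) t)
    (hq : ∀ i, ContDiffAt ℝ ((⊤ : ℕ∞) : WithTop ℕ∞) (fun s => (q s).coeff i) t) (i : ℕ) :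
    ContDiffAt ℝ ((⊤ : ℕ∞) : WithTop ℕ∞) (fun s => (p s * q s).coeff i) t := by
  simp only [coeff_mul]
  exact ContDiffAt.sum fun j _ => (hp _).mul (hq _)

theorem contDiffAt_eval {p : (Fin m → ℝ) → ℝ[X]} {N : ℕ} (hN : ∀ s, (p s).natDegree ≤ N)
    (hp : ∀ i, ContDiffAt ℝ ((⊤ : ℕ∞) : WithTop ℕ∞) (fun s => (p s).coeff i) t) (k : Fin m) :
    ContDiffAt ℝ ((⊤ : ℕ∞) : WithTop ℕ∞) (fun s => (p s).eval (s k)) t := by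
  simp only [fun s => eval_eq_sum_range' (Nat.lt_succ_of_le (hN s))]
  exact ContDiffAt.sum fun i _ => (hp i).mul ((contDiff_apply ℝ ℝ k).contDiffAt.pow i)

theorem natDegree_P_mul_P_le (i j : ℕ) (s : Fin m → ℝ) :
    (P α ω s i * P α ω s j).natDegree ≤ i + j :=
  natDegree_mul_le_of_le (natDegree_P α ω s i).le (natDegree_P α ω s j).le

/-- The orthogonalization writes the coefficients as rational expressions in smooth moments with
nonzero denominators. It is rewritten through `mu` on the chamber only, hence eventually near t. -/
theorem Admissible.contDiffAt_coeff_P (hA : Admissible α ω) (ht : t ∈ chamber m) (n : ℕ) :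
    ∀ i, ContDiffAt ℝ ((⊤ : ℕ∞) : WithTop ℕ∞) (fun s => (P α ω s n).coeff i) t := by
  induction n using Nat.strong_induction_on with
  | _ n ih =>
    intro i
    have heq : (fun s => (P α ω s n).coeff i) =ᶠ[𝓝 t] fun s => (X ^ n : ℝ[X]).coeff i -
        ∑ j : Fin n, mu α ω s (X ^ n * P α ω s j) / mu α ω s (P α ω s j * P α ω s j) *
          (P α ω s j).coeff i := by
      filter_upwards [eventually_mem_chamber ht] with s hs
      rw [P, coeff_sub, finsetSum_coeff]
      simp only [coeff_C_mul, pairing_eq_mu hA.neg_one_lt hs.1]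
    refine ContDiffAt.congr_of_eventuallyEq ?_ heq
    refine contDiffAt_const.sub (ContDiffAt.sum fun j _ => (ContDiffAt.div ?_ ?_ ?_).mul
      (ih j j.isLt i))
    · exact contDiffAt_mu hA.neg_one_lt ht.1 (N := n + j) (fun s => natDegree_mul_le_of_le
        (natDegree_X_pow_le n) (natDegree_P α ω s j).le)
        (contDiffAt_coeff_mul (fun _ => contDiffAt_const) (ih j j.isLt))
    · exact contDiffAt_mu hA.neg_one_lt ht.1 (natDegree_P_mul_P_le _ _)
        (contDiffAt_coeff_mul (ih j j.isLt) (ih j j.isLt))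
    · exact (hA.mu_mul_self_pos ht (P_monic α ω t j).ne_zero).ne'

theorem Admissible.contDiffAt_h (hA : Admissible α ω) (ht : t ∈ chamber m) (n : ℕ) :
    ContDiffAt ℝ ((⊤ : ℕ∞) : WithTop ℕ∞) (h α ω n) t := by
  have heq : h α ω n =ᶠ[𝓝 t] fun s => mu α ω s (P α ω s n * P α ω s n) := by
    filter_upwards [eventually_mem_chamber ht] with s hs using hA.h_eq hs n
  exact (contDiffAt_mu hA.neg_one_lt ht.1 (natDegree_P_mul_P_le n n)
    (contDiffAt_coeff_mul (hA.contDiffAt_coeff_P ht n) (hA.contDiffAt_coeff_P ht n))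
    ).congr_of_eventuallyEq heq

theorem Admissible.contDiffAt_eval_P (hA : Admissible α ω) (ht : t ∈ chamber m) (n : ℕ)
    (k : Fin m) :
    ContDiffAt ℝ ((⊤ : ℕ∞) : WithTop ℕ∞) (fun s => (P α ω s n).eval (s k)) t :=
  contDiffAt_eval (fun s => (natDegree_P α ω s n).le) (hA.contDiffAt_coeff_P ht n) k

theorem contDiffAt_w0_apply (ht : ∀ k, 0 < t k) (k : Fin m) :
    ContDiffAt ℝ ((⊤ : ℕ∞) : WithTop ℕ∞) (fun s : Fin m → ℝ => w0 α (s k)) t :=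
  (contDiffAt_w0 α (ht k)).comp t (contDiff_apply ℝ ℝ k).contDiffAt

theorem Admissible.contDiffAt_R (hA : Admissible α ω) (ht : t ∈ chamber m) (n : ℕ) (k : Fin m) :
    ContDiffAt ℝ ((⊤ : ℕ∞) : WithTop ℕ∞) (R α ω n k) t := by
  unfold R
  exact (contDiffAt_const.mul ((contDiffAt_w0_apply ht.1 k).div (hA.contDiffAt_h ht n)
    (hA.h_pos ht n).ne')).mul ((hA.contDiffAt_eval_P ht n k).pow 2)

theorem Admissible.contDiffAt_r (hA : Admissible α ω) (ht : t ∈ chamber m) (n : ℕ) (k : Fin m) :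
    ContDiffAt ℝ ((⊤ : ℕ∞) : WithTop ℕ∞) (r α ω n k) t := by
  cases n with
  | zero => exact contDiffAt_const
  | succ n =>
    exact ((contDiffAt_const.mul ((contDiffAt_w0_apply ht.1 k).div (hA.contDiffAt_h ht n)
      (hA.h_pos ht n).ne')).mul (hA.contDiffAt_eval_P ht (n + 1) k)).mul
      (hA.contDiffAt_eval_P ht n k)

theorem Admissible.hankel_pos (hA : Admissible α ω) (ht : t ∈ chamber m) (n : ℕ) :
    0 < hankel α ω n t := by
  rw [hA.hankel_eq_prod ht]
  exact Finset.prod_pos fun j _ => hA.h_pos ht j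

theorem Admissible.contDiffAt_hankel (hA : Admissible α ω) (ht : t ∈ chamber m) (n : ℕ) :
    ContDiffAt ℝ ((⊤ : ℕ∞) : WithTop ℕ∞) (hankel α ω n) t := by
  have heq : hankel α ω n =ᶠ[𝓝 t] fun s => ∏ j ∈ Finset.range n, h α ω j s := by
    filter_upwards [eventually_mem_chamber ht] with s hs using hA.hankel_eq_prod hs n
  exact (contDiffAt_prod fun j _ => hA.contDiffAt_h ht j).congr_of_eventuallyEq heq

/-! ### Calculus along lines for functions and for families of polynomials -/

variable {v : Fin m → ℝ}

theorem hasLineDerivAt_of_contDiffAt {f : (Fin m → ℝ) → ℝ}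
    (hf : ContDiffAt ℝ ((⊤ : ℕ∞) : WithTop ℕ∞) f t) (v : Fin m → ℝ) :
    HasLineDerivAt ℝ f (lineDeriv ℝ f t v) t v :=
  (hf.differentiableAt (by simp)).lineDifferentiableAt.hasLineDerivAt

theorem hasLineDerivAt_apply (t v : Fin m → ℝ) (k : Fin m) :
    HasLineDerivAt ℝ (fun s : Fin m → ℝ => s k) (v k) t v := by
  have := ((hasDerivAt_id (0 : ℝ)).mul_const (v k)).const_add (t k)
  simpa [HasLineDerivAt] using this

theorem hasLineDerivAt_comp_apply {f : ℝ → ℝ} {f' : ℝ} {k : Fin m} (hf : HasDerivAt f f' (t k))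
    (v : Fin m → ℝ) : HasLineDerivAt ℝ (fun s : Fin m → ℝ => f (s k)) (f' * v k) t v := by
  have h1 := hasLineDerivAt_apply t v k
  rw [HasLineDerivAt] at h1 ⊢
  exact HasDerivAt.comp (0 : ℝ) (by simpa using hf) h1

theorem hasLineDerivAt_mul {f g : (Fin m → ℝ) → ℝ} {f' g' : ℝ} (hf : HasLineDerivAt ℝ f f' t v)
    (hg : HasLineDerivAt ℝ g g' t v) :
    HasLineDerivAt ℝ (fun s => f s * g s) (f' * g t + f t * g') t v := by
  rw [HasLineDerivAt] at *
  simpa using HasDerivAt.fun_mul hf hg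

theorem hasLineDerivAt_div {f g : (Fin m → ℝ) → ℝ} {f' g' : ℝ} (hf : HasLineDerivAt ℝ f f' t v)
    (hg : HasLineDerivAt ℝ g g' t v) (h0 : g t ≠ 0) :
    HasLineDerivAt ℝ (fun s => f s / g s) ((f' * g t - f t * g') / g t ^ 2) t v := by
  rw [HasLineDerivAt] at *
  have := HasDerivAt.fun_div hf hg (by simpa using h0)
  simpa using this

theorem hasLineDerivAt_sum {ι : Type*} {I : Finset ι} {f : ι → (Fin m → ℝ) → ℝ} {f' : ι → ℝ}
    (hf : ∀ i ∈ I, HasLineDerivAt ℝ (f i) (f' i) t v) :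
    HasLineDerivAt ℝ (fun s => ∑ i ∈ I, f i s) (∑ i ∈ I, f' i) t v := by
  rw [HasLineDerivAt]
  exact HasDerivAt.fun_sum fun i hi => hf i hi

theorem hasLineDerivAt_const (c : ℝ) : HasLineDerivAt ℝ (fun _ : Fin m → ℝ => c) 0 t v :=
  hasDerivAt_const _ _

theorem hasLineDerivAt_mom (hα : -1 < α) (ht : ∀ k, 0 < t k) (i : ℕ) (v : Fin m → ℝ) :
    HasLineDerivAt ℝ (mom α ω i) (-∑ k, v k * (ω k.succ * w0 α (t k)) * t k ^ i) t v := by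
  have h1 : HasLineDerivAt ℝ (fun s => ∑ k : Fin m, ω k.succ * tail α i (s k))
      (∑ k, (0 * tail α i (t k) + ω k.succ * (-(t k ^ i * w0 α (t k)) * v k))) t v :=
    hasLineDerivAt_sum fun k _ => hasLineDerivAt_mul (hasLineDerivAt_const _)
      (hasLineDerivAt_comp_apply (hasDerivAt_tail hα i (ht k)) v)
  have h2 : HasLineDerivAt ℝ (mom α ω i) _ t v := HasDerivAt.const_add (ω 0 * tail α i 0) h1
  convert h2 using 1
  rw [← Finset.sum_neg_distrib]
  exact Finset.sum_congr rfl fun k _ => by ring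

/-- A family of polynomials is differentiable along a line, with the given derivative. -/
def HasPolyDeriv (p : (Fin m → ℝ) → ℝ[X]) (p' : ℝ[X]) (t v : Fin m → ℝ) : Prop :=
  ∀ i, HasLineDerivAt ℝ (fun s => (p s).coeff i) (p'.coeff i) t v

theorem HasPolyDeriv.natDegree_le {p : (Fin m → ℝ) → ℝ[X]} {p' : ℝ[X]} {N : ℕ}
    (hp : HasPolyDeriv p p' t v) (hN : ∀ s, (p s).natDegree ≤ N) : p'.natDegree ≤ N := by
  rw [natDegree_le_iff_coeff_eq_zero]
  intro i hi
  have h1 := hp i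
  have h0 : (fun s => (p s).coeff i) = fun _ => 0 := by
    ext s
    exact coeff_eq_zero_of_natDegree_lt ((hN s).trans_lt hi)
  rw [h0] at h1
  exact h1.unique (hasLineDerivAt_const 0)

theorem HasPolyDeriv.mul {p q : (Fin m → ℝ) → ℝ[X]} {p' q' : ℝ[X]}
    (hp : HasPolyDeriv p p' t v) (hq : HasPolyDeriv q q' t v) :
    HasPolyDeriv (fun s => p s * q s) (p' * q t + p t * q') t v := by
  intro i
  simp only [coeff_add, coeff_mul, ← Finset.sum_add_distrib]
  exact hasLineDerivAt_sum fun j _ => hasLineDerivAt_mul (hp _) (hq _)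

theorem hasPolyDeriv_const (q : ℝ[X]) : HasPolyDeriv (fun _ => q) 0 t v := fun i => by
  simpa using hasLineDerivAt_const (q.coeff i)

theorem HasPolyDeriv.eval {p : (Fin m → ℝ) → ℝ[X]} {p' : ℝ[X]} {N : ℕ}
    (hp : HasPolyDeriv p p' t v) (hN : ∀ s, (p s).natDegree ≤ N) (k : Fin m) :
    HasLineDerivAt ℝ (fun s => (p s).eval (s k))
      (p'.eval (t k) + v k * (derivative (p t)).eval (t k)) t v := by
  simp only [fun s => eval_eq_sum_range' (Nat.lt_succ_of_le (hN s))]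
  have h1 := hasLineDerivAt_sum (I := Finset.range (N + 1)) fun i _ => hasLineDerivAt_mul (hp i)
    (hasLineDerivAt_comp_apply (hasDerivAt_pow i (t k)) v)
  convert h1 using 1
  rw [Finset.sum_add_distrib, eval_eq_sum_range' (Nat.lt_succ_of_le (hp.natDegree_le hN)),
    derivative_eval, sum_over_range' _ _ (N + 1) (Nat.lt_succ_of_le (hN t)), Finset.mul_sum]
  · congr 1
    exact Finset.sum_congr rfl fun i _ => by ring
  · simp

/-- The functional itself moves with t: besides the derivative of the polynomial, each jump
contributes a boundary value. -/
theorem HasPolyDeriv.mu {p : (Fin m → ℝ) → ℝ[X]} {p' : ℝ[X]} {N : ℕ}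
    (hp : HasPolyDeriv p p' t v) (hN : ∀ s, (p s).natDegree ≤ N) (hα : -1 < α)
    (ht : ∀ k, 0 < t k) :
    HasLineDerivAt ℝ (fun s => mu α ω s (p s))
      (mu α ω t p' - ∑ k, v k * (ω k.succ * w0 α (t k)) * (p t).eval (t k)) t v := by
  simp only [fun s => mu_eq_sum (α := α) (ω := ω) (t := s) (hN s)]
  have h1 := hasLineDerivAt_sum (I := Finset.range (N + 1)) fun i _ => hasLineDerivAt_mul (hp i)
    (hasLineDerivAt_mom (ω := ω) hα ht i v)
  convert h1 using 1
  rw [Finset.sum_add_distrib, mu_eq_sum (hp.natDegree_le hN), sub_eq_add_neg,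
    ← Finset.sum_neg_distrib]
  congr 1
  simp only [mul_neg, Finset.mul_sum, Finset.sum_neg_distrib]
  rw [Finset.sum_comm]
  congr 1
  refine Finset.sum_congr rfl fun k _ => ?_
  rw [eval_eq_sum_range' (Nat.lt_succ_of_le (hN t)), Finset.mul_sum]
  exact Finset.sum_congr rfl fun i _ => by ring

/-- The derivative of `P_n` in the parameters, along `v`. -/
def dP (α : ℝ) {m : ℕ} (ω : Fin (m + 1) → ℝ) (t : Fin m → ℝ) (n : ℕ) (v : Fin m → ℝ) : ℝ[X] :=
  ∑ i ∈ Finset.range n, monomial i (lineDeriv ℝ (fun s => (P α ω s n).coeff i) t v)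

theorem coeff_dP (n : ℕ) (v : Fin m → ℝ) (i : ℕ) : (dP α ω t n v).coeff i =
    if i < n then lineDeriv ℝ (fun s => (P α ω s n).coeff i) t v else 0 := by
  simp [dP, coeff_monomial]

theorem degree_dP_lt (n : ℕ) (v : Fin m → ℝ) : (dP α ω t n v).degree < n := by
  rw [degree_lt_iff_coeff_zero]
  intro i hi
  rw [coeff_dP, if_neg (not_lt.2 hi)]

namespace Admissible

theorem hasPolyDeriv_P (hA : Admissible α ω) (ht : t ∈ chamber m) (n : ℕ) (v : Fin m → ℝ) :
    HasPolyDeriv (fun s => P α ω s n) (dP α ω t n v) t v := by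
  intro i
  rw [coeff_dP]
  split_ifs with hi
  · exact hasLineDerivAt_of_contDiffAt (hA.contDiffAt_coeff_P ht n i) v
  · have : ∃ c : ℝ, (fun s : Fin m → ℝ => (P α ω s n).coeff i) = fun _ => c := by
      rcases (not_lt.1 hi).eq_or_lt with rfl | hi
      · exact ⟨1, funext fun s => coeff_P_self α ω s n⟩
      · exact ⟨0, funext fun s => coeff_eq_zero_of_natDegree_lt (by rwa [natDegree_P])⟩
    obtain ⟨c, hc⟩ := this
    rw [hc]
    exact hasLineDerivAt_const c

theorem lineDeriv_eq_of_eventuallyEq_const {f : (Fin m → ℝ) → ℝ} {f' c : ℝ}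
    (hf : HasLineDerivAt ℝ f f' t v) (hc : f =ᶠ[𝓝 t] fun _ => c) : f' = 0 :=
  hf.unique ((hasLineDerivAt_const c).congr_of_eventuallyEq hc)

/-- Differentiate the orthogonality of P_n to a fixed q of lower degree, a relation valid throughout
the chamber. -/
theorem mu_dP_mul (hA : Admissible α ω) (ht : t ∈ chamber m) (n : ℕ) (v : Fin m → ℝ) {q : ℝ[X]}
    (hq : q.degree < n) : mu α ω t (dP α ω t n v * q) =
      ∑ k, v k * (ω k.succ * w0 α (t k)) * ((P α ω t n).eval (t k) * q.eval (t k)) := by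
  have h1 := ((hA.hasPolyDeriv_P ht n v).mul (hasPolyDeriv_const q)).mu (α := α) (ω := ω)
    (N := n + q.natDegree)
    (fun s => natDegree_mul_le_of_le (natDegree_P α ω s n).le le_rfl) hA.neg_one_lt ht.1
  have h2 := lineDeriv_eq_of_eventuallyEq_const h1 (c := 0) (by
    filter_upwards [eventually_mem_chamber ht] with s hs
    exact hA.mu_P_mul_of_degree_lt hs le_rfl hq)
  simp only [mul_zero, add_zero, eval_mul] at h2
  linarith

theorem hasLineDerivAt_h (hA : Admissible α ω) (ht : t ∈ chamber m) (n : ℕ) (v : Fin m → ℝ) :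
    HasLineDerivAt ℝ (h α ω n) (-(∑ k, v k * R α ω n k t) * h α ω n t) t v := by
  have hP := hA.hasPolyDeriv_P ht n v
  have h1 := (hP.mul hP).mu (α := α) (ω := ω) (natDegree_P_mul_P_le n n) hA.neg_one_lt ht.1
  have h2 : HasLineDerivAt ℝ (h α ω n) _ t v := h1.congr_of_eventuallyEq (by
    filter_upwards [eventually_mem_chamber ht] with s hs using hA.h_eq hs n)
  convert h2 using 1
  -- Since P_n is monic, its derivative has lower degree and is orthogonal to P_n; only the boundary
  -- values survive.
  have h3 := hA.mu_P_mul_of_degree_lt ht le_rfl (degree_dP_lt (α := α) (ω := ω) (t := t) n v)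
  rw [map_add, mul_comm (dP α ω t n v), h3, add_zero, zero_sub, neg_mul, Finset.sum_mul]
  congr 1
  refine Finset.sum_congr rfl fun k _ => ?_
  have := (hA.h_pos ht n).ne'
  rw [R, eval_mul]
  field_simp

end Admissible

/-! ### Recurrence and structure relations -/

theorem coeff_X_mul_derivative (p : ℝ[X]) (i : ℕ) :
    (X * derivative p).coeff i = i * p.coeff i := by
  cases i with
  | zero => simp
  | succ i => rw [coeff_X_mul, coeff_derivative]; push_cast; ring

theorem degree_X_mul_derivative_lt {p : ℝ[X]} {d : ℕ} (hp : p.degree < d) :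
    (X * derivative p : ℝ[X]).degree < d := by
  rw [degree_lt_iff_coeff_zero] at hp ⊢
  intro i hi
  rw [coeff_X_mul_derivative, hp i hi, mul_zero]

theorem degree_X_mul_lt {p : ℝ[X]} {d : ℕ} (hp : p.degree < d) :
    (X * p : ℝ[X]).degree < (d + 1 : ℕ) := by
  rw [degree_lt_iff_coeff_zero] at hp ⊢
  rintro (_ | i) hi
  · omega
  · rw [coeff_X_mul, hp i (by omega)]

theorem degree_derivative_P_lt (n : ℕ) : (derivative (P α ω t n)).degree < n := by
  rw [← degree_P α ω t n]
  exact degree_derivative_lt (P_monic α ω t n).ne_zero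

theorem degree_P_lt {n d : ℕ} (h : n < d) : (P α ω t n).degree < d := by
  rw [degree_P]; exact_mod_cast h

theorem nextCoeff_P_succ (n : ℕ) : (P α ω t (n + 1)).nextCoeff = (P α ω t (n + 1)).coeff n := by
  rw [nextCoeff, natDegree_P]; simp

theorem nextCoeff_P_zero : (P α ω t 0).nextCoeff = 0 := by
  rw [P_zero]; simp [nextCoeff]

theorem coeff_X_mul_P (n : ℕ) : (X * P α ω t n).coeff n = (P α ω t n).nextCoeff := by
  cases n with
  | zero => simp [nextCoeff_P_zero]
  | succ n => rw [coeff_X_mul, nextCoeff_P_succ]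

theorem degree_X_mul_P_sub_lt (n : ℕ) : (X * P α ω t n - P α ω t (n + 1) : ℝ[X]).degree <
    (n + 1 : ℕ) := by
  rw [degree_lt_iff_coeff_zero]
  intro i hi
  rcases hi.eq_or_lt with rfl | hi
  · rw [coeff_sub, coeff_X_mul, coeff_P_self, coeff_P_self, sub_self]
  · obtain ⟨i, rfl⟩ : ∃ j, i = j + 1 := ⟨i - 1, by omega⟩
    rw [coeff_sub, coeff_X_mul, coeff_eq_zero_of_natDegree_lt (by rw [natDegree_P]; omega),
      coeff_eq_zero_of_natDegree_lt (by rw [natDegree_P]; omega), sub_self]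

/-- This turns δ into a single directional derivative, along the vector t itself. -/
theorem lineDeriv_self_eq_delta {f : (Fin m → ℝ) → ℝ} (hf : DifferentiableAt ℝ f t) :
    delta f t = lineDeriv ℝ f t t := by
  rw [hf.lineDeriv_eq_fderiv]
  conv_rhs => enter [2]; rw [pi_eq_sum_univ' t]
  rw [map_sum]
  refine Finset.sum_congr rfl fun k _ => ?_
  rw [pd, hf.lineDeriv_eq_fderiv, map_smul, smul_eq_mul]

theorem delta_eq_of_hasLineDerivAt {f : (Fin m → ℝ) → ℝ} {f' : ℝ}
    (hf : ContDiffAt ℝ ((⊤ : ℕ∞) : WithTop ℕ∞) f t) (hf' : HasLineDerivAt ℝ f f' t t) :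
    delta f t = f' := by
  rw [lineDeriv_self_eq_delta (hf.differentiableAt (by simp)), hf'.lineDeriv]

theorem pd_congr {f g : (Fin m → ℝ) → ℝ} (hfg : f =ᶠ[𝓝 t] g) (k : Fin m) : pd k f t = pd k g t :=
  hfg.lineDeriv_eq

theorem delta_congr {f g : (Fin m → ℝ) → ℝ} (hfg : f =ᶠ[𝓝 t] g) : delta f t = delta g t := by
  simp only [delta, pd_congr hfg]

namespace Admissible

/-- Taking v = t makes the boundary sum from differentiating orthogonality equal to the one in the
Pearson relation for P_n q, so the sums cancel. -/
theorem mu_X_mul_derivative_mul (hA : Admissible α ω) (ht : t ∈ chamber m) (n : ℕ) {q : ℝ[X]}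
    (hq : q.degree < n) :
    mu α ω t ((dP α ω t n t + X * derivative (P α ω t n)) * q) =
      mu α ω t (P α ω t n * (X * q)) := by
  have h1 := mu_pearson (ω := ω) hA.neg_one_lt ht.1 (P α ω t n * q)
  have h2 := hA.mu_P_mul_of_degree_lt ht le_rfl (degree_X_mul_derivative_lt hq)
  have h3 := hA.mu_P_mul_of_degree_lt ht le_rfl hq
  have h4 := hA.mu_dP_mul ht n t hq
  rw [derivative_mul, show X * (derivative (P α ω t n) * q + P α ω t n * derivative q) +
    (C (α + 1) - X) * (P α ω t n * q) = X * derivative (P α ω t n) * q +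
      P α ω t n * (X * derivative q) + C (α + 1) * (P α ω t n * q) - P α ω t n * (X * q) by ring,
    map_sub, map_add, map_add, ← smul_eq_C_mul, map_smul, h2, h3] at h1
  simp only [eval_mul] at h1
  rw [add_mul, map_add, h4]
  simp only [smul_zero, add_zero] at h1
  linarith

/-- The recurrence coefficient `α_n` in terms of the `R_{n,k}`. -/
theorem nextCoeff_sub_nextCoeff (hA : Admissible α ω) (ht : t ∈ chamber m) (n : ℕ) :
    (P α ω t n).nextCoeff - (P α ω t (n + 1)).nextCoeff =
      2 * n + 1 + α + ∑ k, t k * R α ω n k t := by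
  have hh := (hA.h_pos ht n).ne'
  have h1 := mu_pearson (ω := ω) hA.neg_one_lt ht.1 (P α ω t n * P α ω t n)
  have h2 := hA.mu_P_mul ht (degree_X_mul_derivative_lt (degree_P_lt (α := α) (ω := ω) (t := t)
    n.lt_succ_self))
  have h3 : mu α ω t (P α ω t n * (X * P α ω t n)) =
      ((P α ω t n).nextCoeff - (P α ω t (n + 1)).nextCoeff) * h α ω n t := by
    have h4 := hA.mu_P_mul ht (degree_X_mul_P_sub_lt (α := α) (ω := ω) (t := t) n)
    have h5 := hA.mu_P_mul_P ht (n + 1) n n.lt_succ_self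
    rw [mul_comm] at h5
    rwa [mul_sub, map_sub, h5, sub_zero, coeff_sub, coeff_X_mul_P, ← nextCoeff_P_succ] at h4
  rw [coeff_X_mul_derivative, coeff_P_self, mul_one] at h2
  rw [derivative_mul, show X * (derivative (P α ω t n) * P α ω t n + P α ω t n *
      derivative (P α ω t n)) + (C (α + 1) - X) * (P α ω t n * P α ω t n) =
      P α ω t n * (X * derivative (P α ω t n)) + P α ω t n * (X * derivative (P α ω t n)) +
      C (α + 1) * (P α ω t n * P α ω t n) - P α ω t n * (X * P α ω t n) by ring,
    map_sub, map_add, map_add, ← smul_eq_C_mul, map_smul, h2, h3, ← hA.h_eq ht, smul_eq_mul] at h1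
  have h6 : ∑ k, t k * (ω k.succ * w0 α (t k)) * (P α ω t n * P α ω t n).eval (t k) =
      (∑ k, t k * R α ω n k t) * h α ω n t := by
    rw [Finset.sum_mul]
    refine Finset.sum_congr rfl fun k _ => ?_
    rw [R, eval_mul]
    field_simp
  rw [h6] at h1
  apply mul_right_cancel₀ hh
  linear_combination -h1

/-- The difference of the two sides has degree at most n and is orthogonal to all such polynomials:
on a test polynomial q, both the left side and the P_n term give h_{n+1} times the coefficient of
x^n in q. -/
theorem dP_add_X_mul_derivative (hA : Admissible α ω) (ht : t ∈ chamber m) (n : ℕ) :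
    dP α ω t (n + 1) t + X * derivative (P α ω t (n + 1)) =
      C ((n : ℝ) + 1) * P α ω t (n + 1) + C (h α ω (n + 1) t / h α ω n t) * P α ω t n := by
  rw [← sub_eq_zero]
  apply hA.eq_zero_of_orthogonal ht (n := n + 1)
  · rw [degree_lt_iff_coeff_zero]
    intro i hi
    have h1 := (degree_lt_iff_coeff_zero _ _).1 (degree_dP_lt (α := α) (ω := ω) (t := t) (n + 1) t)
      i hi
    have h2 : (P α ω t n).coeff i = 0 :=
      coeff_eq_zero_of_natDegree_lt (by rw [natDegree_P]; omega)
    rw [coeff_sub, coeff_add, coeff_add, h1, coeff_X_mul_derivative, coeff_C_mul, coeff_C_mul, h2]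
    rcases hi.eq_or_lt with rfl | hi
    · push_cast; ring
    · rw [coeff_eq_zero_of_natDegree_lt (by rwa [natDegree_P])]; ring
  · intro q hq
    have hh := (hA.h_pos ht n).ne'
    rw [sub_mul, add_mul (C _ * _), map_sub, map_add, hA.mu_X_mul_derivative_mul ht (n + 1) hq,
      mul_assoc, mul_assoc, ← smul_eq_C_mul, ← smul_eq_C_mul, map_smul, map_smul,
      hA.mu_P_mul_of_degree_lt ht le_rfl hq, hA.mu_P_mul ht hq,
      hA.mu_P_mul ht (degree_X_mul_lt hq), coeff_X_mul, smul_eq_mul, smul_eq_mul]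
    field_simp
    ring

/-- A form of the same relation, using P_{n+1} as the neighbour instead of P_{n-1}, so that it also
covers n = 0. The constant is the recurrence coefficient minus n. -/
theorem dP_add_X_mul_derivative' (hA : Admissible α ω) (ht : t ∈ chamber m) (n : ℕ) :
    dP α ω t n t + X * derivative (P α ω t n) =
      (X - C ((P α ω t n).nextCoeff - (P α ω t (n + 1)).nextCoeff - n)) * P α ω t n -
        P α ω t (n + 1) := by
  rw [← sub_eq_zero]
  apply hA.eq_zero_of_orthogonal ht (n := n)
  · have h0 := (degree_lt_iff_coeff_zero _ _).1
      (degree_X_mul_P_sub_lt (α := α) (ω := ω) (t := t) n)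
    rw [degree_lt_iff_coeff_zero]
    intro i hi
    have h1 := (degree_lt_iff_coeff_zero _ _).1 (degree_dP_lt (α := α) (ω := ω) (t := t) n t) i hi
    rw [sub_mul, sub_right_comm, coeff_sub, coeff_add, coeff_sub, h1, coeff_X_mul_derivative,
      coeff_C_mul]
    rcases hi.eq_or_lt with rfl | hi
    · rw [coeff_sub, coeff_X_mul_P, ← nextCoeff_P_succ, coeff_P_self]; ring
    · rw [h0 i hi, coeff_eq_zero_of_natDegree_lt (by rwa [natDegree_P])]; ring
  · intro q hq
    have h1 := hA.mu_P_mul_of_degree_lt ht (Nat.le_succ n) hq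
    have h2 := hA.mu_P_mul_of_degree_lt ht le_rfl hq
    rw [sub_mul, map_sub, hA.mu_X_mul_derivative_mul ht n hq]
    simp only [sub_mul, map_sub, mul_assoc, ← smul_eq_C_mul, smul_mul_assoc, map_smul, h1, h2]
    rw [mul_left_comm]
    simp

/-! ### Derivatives of the auxiliary quantities -/

theorem hasLineDerivAt_eval_P (hA : Admissible α ω) (ht : t ∈ chamber m) (n : ℕ) (k : Fin m) :
    HasLineDerivAt ℝ (fun s => (P α ω s n).eval (s k))
      ((dP α ω t n t + X * derivative (P α ω t n)).eval (t k)) t t := by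
  have := (hA.hasPolyDeriv_P ht n t).eval (fun s => (natDegree_P α ω s n).le) k
  simpa using this

theorem hasLineDerivAt_w0 (ht : ∀ k, 0 < t k) (k : Fin m) :
    HasLineDerivAt ℝ (fun s : Fin m → ℝ => w0 α (s k)) ((α - t k) * w0 α (t k)) t t := by
  convert hasLineDerivAt_comp_apply (hasDerivAt_w0 α (ht k)) t using 1
  have := (ht k).ne'
  field_simp

theorem r_succ_eq (n : ℕ) (k : Fin m) : r α ω (n + 1) k t = ω k.succ * (w0 α (t k) / h α ω n t) *
    (P α ω t (n + 1)).eval (t k) * (P α ω t n).eval (t k) := rfl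

/-- Comparing coefficients of x^n gives δp = p + β for the subleading coefficient p of P_{n+1}, with
β = h_{n+1} / h_n. -/
theorem nextCoeff_eq_beta (hA : Admissible α ω) (ht : t ∈ chamber m) (n : ℕ) :
    (dP α ω t (n + 1) t).coeff n = (P α ω t (n + 1)).nextCoeff + h α ω (n + 1) t / h α ω n t := by
  have h1 := congrArg (fun p => p.coeff n) (hA.dP_add_X_mul_derivative ht n)
  simp only [coeff_add, coeff_X_mul_derivative, coeff_C_mul, coeff_P_self,
    ← nextCoeff_P_succ] at h1
  linarith

/-- Two evaluations of the functional on the derivative of P_{n+1} times P_n are compared: by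
leading coefficient and by boundary values. -/
theorem coeff_dP_eq (hA : Admissible α ω) (ht : t ∈ chamber m) (n : ℕ) (v : Fin m → ℝ) :
    (dP α ω t (n + 1) v).coeff n = ∑ k, v k * r α ω (n + 1) k t := by
  have hh := (hA.h_pos ht n).ne'
  have h1 := hA.mu_P_mul ht (degree_dP_lt (α := α) (ω := ω) (t := t) (n + 1) v)
  have h2 := hA.mu_dP_mul ht (n + 1) v (degree_P_lt (α := α) (ω := ω) (t := t) n.lt_succ_self)
  rw [mul_comm, h2] at h1
  apply mul_right_cancel₀ hh
  rw [← h1, Finset.sum_mul]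
  refine Finset.sum_congr rfl fun k _ => ?_
  rw [r_succ_eq]
  field_simp

theorem delta_R (hA : Admissible α ω) (ht : t ∈ chamber m) (n : ℕ) (k : Fin m) :
    delta (R α ω n k) t = 2 * r α ω n k t +
      (∑ j, t j * R α ω n j t - t k + 2 * n + α) * R α ω n k t := by
  have hh := (hA.h_pos ht n).ne'
  have he := hA.hasLineDerivAt_eval_P ht n k
  have h1 := hasLineDerivAt_mul (hasLineDerivAt_mul (hasLineDerivAt_const (ω k.succ))
    (hasLineDerivAt_div (hasLineDerivAt_w0 (α := α) ht.1 k) (hA.hasLineDerivAt_h ht n t) hh))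
    (hasLineDerivAt_mul he he)
  have hR : R α ω n k = fun s => ω k.succ * (w0 α (s k) / h α ω n s) *
      ((P α ω s n).eval (s k) * (P α ω s n).eval (s k)) := by
    ext s; rw [R, pow_two]
  rw [← hR] at h1
  rw [delta_eq_of_hasLineDerivAt (hA.contDiffAt_R ht n k) h1]
  cases n with
  | zero =>
    -- At n = 0 there is no lower neighbour; P_0 is constant and r_{0,k} = 0 takes the place of the
    -- missing term.
    have h0 : dP α ω t 0 t + X * derivative (P α ω t 0) = 0 := by simp [P_zero, dP]
    rw [h0]
    generalize ∑ j, t j * R α ω 0 j t = S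
    simp only [R, r, P_zero, eval_one, eval_zero]
    field_simp
    push_cast
    ring
  | succ n =>
    have hn := (hA.h_pos ht n).ne'
    rw [hA.dP_add_X_mul_derivative ht n]
    generalize ∑ j, t j * R α ω (n + 1) j t = S
    simp only [R, r, eval_add, eval_mul, eval_C]
    field_simp
    push_cast
    ring

/-- P_{n+1}(t_k) is differentiated by the lowering relation and P_n(t_k) by the raising one. The
multiples of r_{n+1,k} then cancel, thanks to the value of the recurrence coefficient, and no
R_{n-1,k} appears. -/
theorem delta_r_succ (hA : Admissible α ω) (ht : t ∈ chamber m) (n : ℕ) (k : Fin m) :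
    delta (r α ω (n + 1) k) t =
      h α ω (n + 1) t / h α ω n t * (R α ω n k t - R α ω (n + 1) k t) := by
  have hh := (hA.h_pos ht n).ne'
  have hh' := (hA.h_pos ht (n + 1)).ne'
  have h1 : HasLineDerivAt ℝ (r α ω (n + 1) k) _ t t :=
    hasLineDerivAt_mul (hasLineDerivAt_mul (hasLineDerivAt_mul (hasLineDerivAt_const _)
      (hasLineDerivAt_div (hasLineDerivAt_w0 ht.1 k) (hA.hasLineDerivAt_h ht n t) hh))
      (hA.hasLineDerivAt_eval_P ht (n + 1) k)) (hA.hasLineDerivAt_eval_P ht n k)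
  rw [delta_eq_of_hasLineDerivAt (hA.contDiffAt_r ht (n + 1) k) h1,
    hA.dP_add_X_mul_derivative ht n, hA.dP_add_X_mul_derivative' ht n,
    hA.nextCoeff_sub_nextCoeff ht n]
  generalize ∑ j, t j * R α ω n j t = S
  simp only [R, eval_add, eval_sub, eval_mul, eval_C, eval_X]
  field_simp
  ring

/-! ### The logarithmic derivative of the Hankel determinant -/

theorem sigma_eq (hA : Admissible α ω) (ht : t ∈ chamber m) (n : ℕ) :
    sigma α ω n t = n * (n + α) + (P α ω t n).nextCoeff := by
  have heq : (fun s => Real.log (hankel α ω n s)) =ᶠ[𝓝 t]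
      fun s => ∑ j ∈ Finset.range n, Real.log (h α ω j s) := by
    filter_upwards [eventually_mem_chamber ht] with s hs
    rw [hA.hankel_eq_prod hs, Real.log_prod fun j _ => (hA.h_pos hs j).ne']
  have h1 : HasLineDerivAt ℝ (fun s => ∑ j ∈ Finset.range n, Real.log (h α ω j s))
      (∑ j ∈ Finset.range n, -∑ k, t k * R α ω j k t) t t := by
    refine hasLineDerivAt_sum fun j _ => ?_
    have hh := (hA.h_pos ht j).ne'
    have h2 := hA.hasLineDerivAt_h ht j t
    rw [HasLineDerivAt] at h2 ⊢
    have h3 := HasDerivAt.log h2 (by simpa using hh)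
    refine h3.congr_deriv ?_
    simp only [zero_smul, add_zero]
    field_simp
  have h2 : ContDiffAt ℝ ((⊤ : ℕ∞) : WithTop ℕ∞)
      (fun s => ∑ j ∈ Finset.range n, Real.log (h α ω j s)) t :=
    ContDiffAt.sum fun j _ => (hA.contDiffAt_h ht j).log (hA.h_pos ht j).ne'
  rw [sigma, delta_congr heq, delta_eq_of_hasLineDerivAt h2 h1]
  -- The sum of the δ ln h_j telescopes, since each ∑ t_k R_{j,k} is a difference of consecutive
  -- subleading coefficients minus 2j + 1 + α.
  clear h1 h2 heq
  induction n with
  | zero => simp [nextCoeff_P_zero]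
  | succ n ih =>
    rw [Finset.sum_range_succ, ih]
    push_cast
    linear_combination hA.nextCoeff_sub_nextCoeff ht n

theorem sigma_eventuallyEq (hA : Admissible α ω) (ht : t ∈ chamber m) (n : ℕ) :
    sigma α ω n =ᶠ[𝓝 t] fun s => n * (n + α) + (P α ω s n).nextCoeff := by
  filter_upwards [eventually_mem_chamber ht] with s hs using hA.sigma_eq hs n

theorem contDiffAt_sigma (hA : Admissible α ω) (ht : t ∈ chamber m) (n : ℕ) :
    ContDiffAt ℝ ((⊤ : ℕ∞) : WithTop ℕ∞) (sigma α ω n) t := by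
  refine ContDiffAt.congr_of_eventuallyEq (contDiffAt_const.add ?_) (hA.sigma_eventuallyEq ht n)
  cases n with
  | zero => simp only [nextCoeff_P_zero]; exact contDiffAt_const
  | succ n => simp only [nextCoeff_P_succ]; exact hA.contDiffAt_coeff_P ht _ _

theorem hasLineDerivAt_sigma (hA : Admissible α ω) (ht : t ∈ chamber m) (n : ℕ) (v : Fin m → ℝ) :
    HasLineDerivAt ℝ (sigma α ω n) (∑ k, v k * r α ω n k t) t v := by
  refine HasLineDerivAt.congr_of_eventuallyEq ?_ (hA.sigma_eventuallyEq ht n)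
  refine HasDerivAt.const_add _ ?_
  cases n with
  | zero => simpa [nextCoeff_P_zero, r] using hasDerivAt_const (0 : ℝ) (0 : ℝ)
  | succ n =>
    rw [← hA.coeff_dP_eq ht]
    simp only [nextCoeff_P_succ]
    exact hA.hasPolyDeriv_P ht (n + 1) v n

theorem pd_sigma (hA : Admissible α ω) (ht : t ∈ chamber m) (n : ℕ) (k : Fin m) :
    pd k (sigma α ω n) t = r α ω n k t := by
  rw [pd, (hA.hasLineDerivAt_sigma ht n _).lineDeriv]
  simp [Pi.single_apply]

theorem delta_sigma (hA : Admissible α ω) (ht : t ∈ chamber m) (n : ℕ) :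
    delta (sigma α ω n) t = ∑ k, t k * r α ω n k t := by
  simp only [delta, hA.pd_sigma ht]

theorem betaExpr_zero (hA : Admissible α ω) (ht : t ∈ chamber m) : betaExpr α ω 0 t = 0 := by
  simp [betaExpr, hA.delta_sigma ht, hA.sigma_eq ht, nextCoeff_P_zero, r]

theorem betaExpr_succ (hA : Admissible α ω) (ht : t ∈ chamber m) (n : ℕ) :
    betaExpr α ω (n + 1) t = h α ω (n + 1) t / h α ω n t := by
  rw [betaExpr, hA.delta_sigma ht, hA.sigma_eq ht, ← hA.coeff_dP_eq ht, hA.nextCoeff_eq_beta ht]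
  ring

/-! ### The quadratic relation at the origin -/

/-- Up to a constant factor, q is the Christoffel–Darboux kernel with one argument at 0. -/
theorem exists_kernel_at_zero (n : ℕ) : ∃ q : ℝ[X],
    X * q = C ((P α ω t (n + 1)).eval 0) * P α ω t n - C ((P α ω t n).eval 0) * P α ω t (n + 1) ∧
      q.degree < (n + 1 : ℕ) ∧ q.coeff n = -(P α ω t n).eval 0 := by
  obtain ⟨q, hq⟩ := X_dvd_iff.2 (show (C ((P α ω t (n + 1)).eval 0) * P α ω t n -
    C ((P α ω t n).eval 0) * P α ω t (n + 1)).coeff 0 = 0 by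
      rw [coeff_zero_eq_eval_zero]; simp; ring)
  have hc : ∀ i, q.coeff i = (P α ω t (n + 1)).eval 0 * (P α ω t n).coeff (i + 1) -
      (P α ω t n).eval 0 * (P α ω t (n + 1)).coeff (i + 1) := fun i => by
    rw [← coeff_X_mul, ← hq, coeff_sub, coeff_C_mul, coeff_C_mul]
  have hc0 : ∀ i, n ≤ i → (P α ω t n).coeff (i + 1) = 0 := fun i hi =>
    coeff_eq_zero_of_natDegree_lt (by rw [natDegree_P]; omega)
  refine ⟨q, hq.symm, ?_, ?_⟩
  · rw [degree_lt_iff_coeff_zero]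
    intro i hi
    rw [hc, hc0 i (by omega), coeff_eq_zero_of_natDegree_lt (by rw [natDegree_P]; omega)]
    ring
  · rw [hc, hc0 n le_rfl, coeff_P_self]; ring

/-- The Pearson relation for P_{n+1} q and for P_n q gives two equations linear in a = P_{n+1}(0)
and b = P_n(0). Their product, divided by ab ≠ 0, is the claim. -/
theorem quadratic_relation_succ (hA : Admissible α ω) (ht : t ∈ chamber m) (n : ℕ) :
    h α ω (n + 1) t / h α ω n t * (1 - ∑ k, R α ω n k t) * (1 - ∑ k, R α ω (n + 1) k t) =
      (n + 1 + α + ∑ k, r α ω (n + 1) k t) * (n + 1 + ∑ k, r α ω (n + 1) k t) := by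
  have hh := (hA.h_pos ht n).ne'
  have hh' := (hA.h_pos ht (n + 1)).ne'
  obtain ⟨q, hq, hdeg, hcoeff⟩ := exists_kernel_at_zero (α := α) (ω := ω) (t := t) n
  have ha := hA.P_eval_zero_ne_zero ht (n + 1)
  have hb := hA.P_eval_zero_ne_zero ht n
  set a := (P α ω t (n + 1)).eval 0
  set b := (P α ω t n).eval 0
  have heval : ∀ x, x * q.eval x = a * (P α ω t n).eval x - b * (P α ω t (n + 1)).eval x := by
    intro x
    simpa using congrArg (eval x) hq
  -- The factor x in front of the derivative of p combines with q into the numerator of the kernel,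
  -- so orthogonality evaluates every term. The same factor t_k turns the boundary values into R's
  -- and r's below.
  have hexp : ∀ p : ℝ[X], X * derivative (p * q) + (C (α + 1) - X) * (p * q) =
      a • (derivative p * P α ω t n) - b • (derivative p * P α ω t (n + 1)) +
        p * (X * derivative q) + (α + 1) • (p * q) - p * (X * q) := by
    intro p
    rw [derivative_mul, show X * (derivative p * q + p * derivative q) =
      derivative p * (X * q) + p * (X * derivative q) by ring, hq]
    simp only [smul_eq_C_mul]
    rw [sub_mul (C (α + 1)), show X * (p * q) = p * (X * q) by ring, hq]
    ring
  have hder : (derivative (P α ω t (n + 1))).coeff n = n + 1 := by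
    rw [coeff_derivative, coeff_P_self, one_mul]
  have hd1 := degree_derivative_P_lt (α := α) (ω := ω) (t := t) (n + 1)
  have hd0 := degree_derivative_P_lt (α := α) (ω := ω) (t := t) n
  have hd0' : (derivative (P α ω t n)).degree < (n + 1 : ℕ) :=
    hd0.trans (by exact_mod_cast n.lt_succ_self)
  have e1 := mu_pearson (ω := ω) hA.neg_one_lt ht.1 (P α ω t (n + 1) * q)
  have e2 := mu_pearson (ω := ω) hA.neg_one_lt ht.1 (P α ω t n * q)
  rw [hexp] at e1 e2
  simp only [map_sub, map_add, map_smul, smul_eq_mul] at e1 e2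
  rw [mul_comm (derivative _), hA.mu_P_mul ht hd1, hder, mul_comm (derivative _),
    hA.mu_P_mul_of_degree_lt ht le_rfl hd1,
    hA.mu_P_mul_of_degree_lt ht le_rfl (degree_X_mul_derivative_lt hdeg),
    hA.mu_P_mul_of_degree_lt ht le_rfl hdeg, hA.mu_P_mul ht (degree_X_mul_lt hdeg), coeff_X_mul,
    hcoeff] at e1
  have hXq : mu α ω t (P α ω t n * (X * q)) = a * h α ω n t := by
    rw [hq, mul_sub, map_sub, mul_left_comm, mul_left_comm _ (C b), ← smul_eq_C_mul,
      ← smul_eq_C_mul, map_smul, map_smul, ← hA.h_eq ht, mul_comm (P α ω t n),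
      hA.mu_P_mul_P ht (n + 1) n n.lt_succ_self]
    simp
  rw [mul_comm (derivative _), hA.mu_P_mul_of_degree_lt ht le_rfl hd0, mul_comm (derivative _),
    hA.mu_P_mul_of_degree_lt ht le_rfl hd0',
    hA.mu_P_mul ht (degree_X_mul_derivative_lt hdeg), coeff_X_mul_derivative,
    hA.mu_P_mul ht hdeg, hXq, hcoeff] at e2
  have s1 : ∑ k, t k * (ω k.succ * w0 α (t k)) * (P α ω t (n + 1) * q).eval (t k) =
      a * h α ω n t * (∑ k, r α ω (n + 1) k t) -
        b * h α ω (n + 1) t * ∑ k, R α ω (n + 1) k t := by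
    rw [Finset.mul_sum, Finset.mul_sum, ← Finset.sum_sub_distrib]
    refine Finset.sum_congr rfl fun k _ => ?_
    rw [r_succ_eq, R, eval_mul]
    field_simp
    linear_combination ω k.succ * w0 α (t k) * (P α ω t (n + 1)).eval (t k) * heval (t k)
  have s2 : ∑ k, t k * (ω k.succ * w0 α (t k)) * (P α ω t n * q).eval (t k) =
      a * h α ω n t * (∑ k, R α ω n k t) -
        b * h α ω n t * ∑ k, r α ω (n + 1) k t := by
    rw [Finset.mul_sum, Finset.mul_sum, ← Finset.sum_sub_distrib]
    refine Finset.sum_congr rfl fun k _ => ?_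
    rw [r_succ_eq, R, eval_mul]
    field_simp
    linear_combination ω k.succ * w0 α (t k) * (P α ω t n).eval (t k) * heval (t k)
  rw [s1] at e1
  rw [s2] at e2
  generalize ∑ k, R α ω n k t = A at *
  generalize ∑ k, R α ω (n + 1) k t = B at *
  generalize ∑ k, r α ω (n + 1) k t = D at *
  have f1 : h α ω (n + 1) t * b * (1 - B) = -(h α ω n t * a * (n + 1 + D)) := by
    linear_combination e1
  have f2 : a * (1 - A) = -(b * (n + 1 + α + D)) := by
    apply mul_right_cancel₀ hh
    linear_combination -e2
  rw [div_mul_eq_mul_div, div_mul_eq_mul_div, div_eq_iff hh]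
  apply mul_right_cancel₀ (mul_ne_zero ha hb)
  linear_combination a * (1 - A) * f1 - h α ω n t * a * (n + 1 + D) * f2

/-- The quantities `R_{n-1,k}` (zero for `n = 0`) parametrize the derivatives of the `r_{n,k}`. -/
theorem exists_previous_R (hA : Admissible α ω) (ht : t ∈ chamber m) (n : ℕ) :
    ∃ ρ : Fin m → ℝ,
      0 ≤ betaExpr α ω n t ∧
      (∀ k, delta (r α ω n k) t = betaExpr α ω n t * (ρ k - R α ω n k t)) ∧
      (∀ k, r α ω n k t ^ 2 = betaExpr α ω n t * (R α ω n k t * ρ k)) ∧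
      betaExpr α ω n t * (1 - ∑ k, ρ k) * (1 - ∑ k, R α ω n k t) =
        (n + α + ∑ k, r α ω n k t) * (n + ∑ k, r α ω n k t) ∧
      ∀ k, ∃ c, 0 ≤ c ∧ ρ k = ω k.succ * c := by
  cases n with
  | zero =>
    -- For n = 0 both β and the r's vanish, so zero is a consistent choice for the missing R_{-1,k}.
    refine ⟨0, (hA.betaExpr_zero ht).ge, fun k => ?_, fun k => ?_, ?_, fun k => ⟨0, le_rfl, ?_⟩⟩
    · rw [hA.betaExpr_zero ht, zero_mul]
      exact delta_eq_of_hasLineDerivAt contDiffAt_const (hasLineDerivAt_const 0)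
    · simp [r]
    · simp [r, hA.betaExpr_zero ht]
    · simp
  | succ n =>
    have hh := hA.h_pos ht n
    have hh' := hA.h_pos ht (n + 1)
    rw [hA.betaExpr_succ ht]
    refine ⟨fun k => R α ω n k t, (div_pos hh' hh).le, hA.delta_r_succ ht n, fun k => ?_, ?_,
      fun k => ⟨w0 α (t k) / h α ω n t * (P α ω t n).eval (t k) ^ 2, ?_, ?_⟩⟩
    · simp only [r_succ_eq, R]
      field_simp
    · rw [hA.quadratic_relation_succ ht n]
      push_cast
      ring
    · exact mul_nonneg (div_pos (w0_pos α (ht.1 k)) hh).le (sq_nonneg _)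
    · simp only [R]; ring

end Admissible

/-! ### Second order operators -/

theorem pd_eventuallyEq_fderiv {f : (Fin m → ℝ) → ℝ}
    (hf : ContDiffAt ℝ ((⊤ : ℕ∞) : WithTop ℕ∞) f t) (k : Fin m) :
    pd k f =ᶠ[𝓝 t] fun s => fderiv ℝ f s (Pi.single k 1) := by
  filter_upwards [(hf.of_le (m := 1) (by exact_mod_cast le_top)).eventually (by simp)] with s hs
  exact (hs.differentiableAt (by simp)).lineDeriv_eq_fderiv

theorem contDiffAt_pd {f : (Fin m → ℝ) → ℝ} (hf : ContDiffAt ℝ ((⊤ : ℕ∞) : WithTop ℕ∞) f t)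
    (k : Fin m) : ContDiffAt ℝ ((⊤ : ℕ∞) : WithTop ℕ∞) (pd k f) t :=
  ((hf.fderiv_right (m := ((⊤ : ℕ∞) : WithTop ℕ∞)) (by simp)).clm_apply
    contDiffAt_const).congr_of_eventuallyEq (pd_eventuallyEq_fderiv hf k)

theorem pd_pd_eq_fderiv {f : (Fin m → ℝ) → ℝ}
    (hf : ContDiffAt ℝ ((⊤ : ℕ∞) : WithTop ℕ∞) f t) (j k : Fin m) :
    pd j (pd k f) t = fderiv ℝ (fderiv ℝ f) t (Pi.single j 1) (Pi.single k 1) := by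
  have hd : DifferentiableAt ℝ (fderiv ℝ f) t :=
    (hf.fderiv_right (m := ((⊤ : ℕ∞) : WithTop ℕ∞)) (by simp)).differentiableAt (by simp)
  rw [pd_congr (pd_eventuallyEq_fderiv hf k), pd]
  have h1 := hd.hasFDerivAt.clm_apply (hasFDerivAt_const (Pi.single k (1 : ℝ)) t)
  rw [h1.differentiableAt.lineDeriv_eq_fderiv, h1.fderiv]
  simp

theorem pd_comm {f : (Fin m → ℝ) → ℝ} (hf : ContDiffAt ℝ ((⊤ : ℕ∞) : WithTop ℕ∞) f t)
    (j k : Fin m) : pd j (pd k f) t = pd k (pd j f) t := by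
  rw [pd_pd_eq_fderiv hf, pd_pd_eq_fderiv hf]
  exact (hf.isSymmSndFDerivAt (by simpa using WithTop.coe_le_coe.2 (le_top : (2 : ℕ∞) ≤ ⊤))).eq _ _

theorem contDiffAt_apply_mul {f : (Fin m → ℝ) → ℝ}
    (hf : ContDiffAt ℝ ((⊤ : ℕ∞) : WithTop ℕ∞) f t) (k : Fin m) :
    ContDiffAt ℝ ((⊤ : ℕ∞) : WithTop ℕ∞) (fun s => s k * f s) t :=
  (contDiff_apply ℝ ℝ k).contDiffAt.mul hf

/-- Differentiating the coefficients t_k produces the extra δ; symmetry of mixed partials folds the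
terms with j > k onto those with j < k. -/
theorem delta_delta {f : (Fin m → ℝ) → ℝ} (hf : ContDiffAt ℝ ((⊤ : ℕ∞) : WithTop ℕ∞) f t) :
    delta (delta f) t = delta2 f t := by
  have h1 : HasLineDerivAt ℝ (delta f)
      (∑ k, (t k * pd k f t + t k * ∑ j, t j * pd j (pd k f) t)) t t := by
    refine hasLineDerivAt_sum fun k _ => hasLineDerivAt_mul (hasLineDerivAt_apply t t k) ?_
    have h2 := contDiffAt_pd hf k
    have h3 := hasLineDerivAt_of_contDiffAt h2 t
    rwa [← lineDeriv_self_eq_delta (h2.differentiableAt (by simp))] at h3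
  have h2 : ContDiffAt ℝ ((⊤ : ℕ∞) : WithTop ℕ∞) (delta f) t :=
    ContDiffAt.sum fun k _ => contDiffAt_apply_mul (contDiffAt_pd hf k) k
  rw [delta_eq_of_hasLineDerivAt h2 h1, delta2, Finset.sum_add_distrib, add_comm]
  congr 1
  have hsplit : ∀ k : Fin m, ∀ g : Fin m → ℝ,
      ∑ j, g j = ∑ j ∈ Finset.Iio k, g j + g k + ∑ j ∈ Finset.Ioi k, g j := by
    intro k g
    rw [← Finset.sum_filter_add_sum_filter_not Finset.univ (· < k)]
    have e1 : Finset.univ.filter (· < k) = Finset.Iio k := by ext; simp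
    have e2 : Finset.univ.filter (fun j => ¬ j < k) = insert k (Finset.Ioi k) := by
      ext j; simp [le_iff_eq_or_lt]
    rw [e1, e2, Finset.sum_insert (by simp), add_assoc]
  have hswap : ∑ k : Fin m, ∑ j ∈ Finset.Ioi k, t k * (t j * pd j (pd k f) t) =
      ∑ k : Fin m, ∑ j ∈ Finset.Iio k, t k * (t j * pd j (pd k f) t) := by
    rw [Finset.sum_comm' (t' := Finset.univ) (s' := fun j => Finset.Iio j) (by simp)]
    refine Finset.sum_congr rfl fun k _ => Finset.sum_congr rfl fun j _ => ?_
    rw [pd_comm hf]; ring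
  simp only [Finset.mul_sum]
  rw [Finset.sum_congr rfl fun k _ => hsplit k _, Finset.sum_add_distrib, Finset.sum_add_distrib,
    hswap]
  have e3 : ∑ k : Fin m, t k * (t k * pd k (pd k f) t) = ∑ k, t k ^ 2 * pd k (pd k f) t :=
    Finset.sum_congr rfl fun k _ => by ring
  have e4 : ∑ k : Fin m, ∑ j ∈ Finset.Iio k, t k * (t j * pd j (pd k f) t) =
      ∑ k : Fin m, ∑ j ∈ Finset.Iio k, t j * t k * pd j (pd k f) t :=
    Finset.sum_congr rfl fun k _ => Finset.sum_congr rfl fun j _ => by ring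
  rw [e3, e4]
  simp only [← Finset.mul_sum]
  ring

/-! ### Elimination of R_{n-1,k}: the coupled system and the σ-form -/

namespace Admissible

/-- Exchanging partials, the sum is δ of ∂_k σ_n, and ∂_k σ_n is r_{n,k} near t. -/
theorem mixed_eq (hA : Admissible α ω) (ht : t ∈ chamber m) (n : ℕ) (k : Fin m) :
    ∑ j : Fin m, t j * pd k (pd j (sigma α ω n)) t = delta (r α ω n k) t := by
  have heq : pd k (sigma α ω n) =ᶠ[𝓝 t] r α ω n k := by
    filter_upwards [eventually_mem_chamber ht] with s hs using hA.pd_sigma hs n k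
  rw [← delta_congr heq, delta]
  exact Finset.sum_congr rfl fun j _ => by rw [pd_comm (hA.contDiffAt_sigma ht n)]

theorem delta_delta_R (hA : Admissible α ω) (ht : t ∈ chamber m) (n : ℕ) (k : Fin m) :
    delta (delta (R α ω n k)) t = 2 * delta (r α ω n k) t +
      (∑ j, t j * delta (R α ω n j) t + ∑ j, t j * R α ω n j t - t k) * R α ω n k t +
      (∑ j, t j * R α ω n j t - t k + 2 * n + α) * delta (R α ω n k) t := by
  have heq : delta (R α ω n k) =ᶠ[𝓝 t] fun s => 2 * r α ω n k s +
      (∑ j, s j * R α ω n j s + -1 * s k + (2 * n + α)) * R α ω n k s := by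
    filter_upwards [eventually_mem_chamber ht] with s hs
    rw [hA.delta_R hs n k]
    ring
  have hR : ∀ j, HasLineDerivAt ℝ (R α ω n j) (delta (R α ω n j) t) t t := fun j => by
    rw [lineDeriv_self_eq_delta ((hA.contDiffAt_R ht n j).differentiableAt (by simp))]
    exact hasLineDerivAt_of_contDiffAt (hA.contDiffAt_R ht n j) t
  have hr : HasLineDerivAt ℝ (r α ω n k) (delta (r α ω n k) t) t t := by
    rw [lineDeriv_self_eq_delta ((hA.contDiffAt_r ht n k).differentiableAt (by simp))]
    exact hasLineDerivAt_of_contDiffAt (hA.contDiffAt_r ht n k) t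
  have hsum : HasLineDerivAt ℝ (fun s : Fin m → ℝ => ∑ j, s j * R α ω n j s)
      (∑ j, (t j * R α ω n j t + t j * delta (R α ω n j) t)) t t :=
    hasLineDerivAt_sum fun j _ => hasLineDerivAt_mul (hasLineDerivAt_apply t t j) (hR j)
  have hlin := hasLineDerivAt_mul (hasLineDerivAt_const (t := t) (v := t) (-1))
    (hasLineDerivAt_apply t t k)
  have hfac : HasLineDerivAt ℝ
      (fun s : Fin m → ℝ => ∑ j, s j * R α ω n j s + -1 * s k + (2 * n + α)) _ t t :=
    HasDerivAt.add_const (2 * n + α) (HasDerivAt.fun_add hsum hlin)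
  have hall : HasLineDerivAt ℝ (fun s : Fin m → ℝ => 2 * r α ω n k s +
      (∑ j, s j * R α ω n j s + -1 * s k + (2 * n + α)) * R α ω n k s) _ t t :=
    HasDerivAt.fun_add (hasLineDerivAt_mul (hasLineDerivAt_const 2) hr)
      (hasLineDerivAt_mul hfac (hR k))
  have hsmooth : ContDiffAt ℝ ((⊤ : ℕ∞) : WithTop ℕ∞) (delta (R α ω n k)) t :=
    ContDiffAt.sum fun j _ => contDiffAt_apply_mul (contDiffAt_pd (hA.contDiffAt_R ht n k) j) j
  rw [delta_eq_of_hasLineDerivAt hsmooth (hall.congr_of_eventuallyEq heq),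
    Finset.sum_add_distrib]
  ring

theorem R_eq_mul (hA : Admissible α ω) (ht : t ∈ chamber m) (n : ℕ) (k : Fin m) :
    ∃ c, 0 ≤ c ∧ R α ω n k t = ω k.succ * c :=
  ⟨w0 α (t k) / h α ω n t * (P α ω t n).eval (t k) ^ 2,
    mul_nonneg (div_pos (w0_pos α (ht.1 k)) (hA.h_pos ht n)).le (sq_nonneg _), by rw [R]; ring⟩

/-- The identities with denominators, where these do not vanish. -/
theorem coupled_system (hA : Admissible α ω) (ht : t ∈ chamber m) (n : ℕ)
    (hR : ∀ k, ω k.succ ≠ 0 → R α ω n k t ≠ 0) (hsum : ∑ j, R α ω n j t ≠ 1) :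
    betaExpr α ω n t = (n + α + ∑ j, r α ω n j t) * (n + ∑ j, r α ω n j t) /
        (1 - ∑ j, R α ω n j t) + ∑ j, r α ω n j t ^ 2 / R α ω n j t ∧
      ∀ k, delta (r α ω n k) t = r α ω n k t ^ 2 / R α ω n k t -
        R α ω n k t * betaExpr α ω n t := by
  obtain ⟨ρ, -, hδ, hsq, hquad, hsign⟩ := hA.exists_previous_R ht n
  have hdiv : ∀ k, r α ω n k t ^ 2 / R α ω n k t = betaExpr α ω n t * ρ k := by
    intro k
    -- Without a jump at t_k both sides are 0, the quotient because division by zero returns 0; this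
    -- matches the stated convention.
    by_cases hk : ω k.succ = 0
    · obtain ⟨c, -, hc⟩ := hsign k
      rw [hc, hk, R, hk]; simp
    · have := hR k hk
      rw [hsq]
      field_simp
  refine ⟨?_, fun k => ?_⟩
  · simp only [hdiv]
    have h1 : 1 - ∑ j, R α ω n j t ≠ 0 := sub_ne_zero.2 (Ne.symm hsum)
    rw [← hquad, mul_div_assoc, div_self h1, ← Finset.mul_sum]
    ring
  · rw [hδ, hdiv]; ring

/-- With δr = β(ρ - R) and r² = βρR, the quantity Δ_k completes to a square. Since β ≥ 0 and ρ_k,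
R_{n,k} are nonnegative multiples of ω_k, the factor sgn(ω_k) recovers the sign lost in the square
root. -/
theorem sign_mul_sqrt_Delta (hA : Admissible α ω) (ht : t ∈ chamber m) (n : ℕ) :
    ∃ ρ : Fin m → ℝ,
      (∀ k, delta (r α ω n k) t = betaExpr α ω n t * (ρ k - R α ω n k t)) ∧
      betaExpr α ω n t * (1 - ∑ k, ρ k) * (1 - ∑ k, R α ω n k t) =
        (n + α + ∑ k, r α ω n k t) * (n + ∑ k, r α ω n k t) ∧
      (∀ k, Delta α ω n k t = (betaExpr α ω n t * (ρ k + R α ω n k t)) ^ 2) ∧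
      ∀ k, Real.sign (ω k.succ) * Real.sqrt (Delta α ω n k t) =
        betaExpr α ω n t * (ρ k + R α ω n k t) := by
  obtain ⟨ρ, hβ, hδ, hsq, hquad, hsign⟩ := hA.exists_previous_R ht n
  have hD : ∀ k, Delta α ω n k t = (betaExpr α ω n t * (ρ k + R α ω n k t)) ^ 2 := by
    intro k
    rw [Delta, mixed, hA.mixed_eq ht, hA.pd_sigma ht, hsq, hδ]
    ring
  refine ⟨ρ, hδ, hquad, hD, fun k => ?_⟩
  obtain ⟨c, hc, hρ⟩ := hsign k
  obtain ⟨d, hd, hRk⟩ := hA.R_eq_mul ht n k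
  have hcd : 0 ≤ betaExpr α ω n t * (c + d) := mul_nonneg hβ (add_nonneg hc hd)
  have hfac : betaExpr α ω n t * (ρ k + R α ω n k t) =
      ω k.succ * (betaExpr α ω n t * (c + d)) := by rw [hρ, hRk]; ring
  rw [hD, Real.sqrt_sq_eq_abs, hfac, abs_mul, abs_of_nonneg hcd, ← mul_assoc]
  congr 1
  rcases lt_trichotomy (ω k.succ) 0 with hk | hk | hk
  · rw [Real.sign_of_neg hk, abs_of_neg hk]; ring
  · rw [hk]; simp
  · rw [Real.sign_of_pos hk, abs_of_pos hk]; ring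

end Admissible

end

end LaguerreJump

/-! ### Assembly of the theorem -/

theorem theorem1p1 (α : ℝ) (hα : -1 < α) (m : ℕ) (ω : Fin (m + 1) → ℝ)
    (hω : ∀ l : Fin (m + 1), 0 ≤ ∑ k ∈ Finset.Iic l, ω k) (hω_ne : ω ≠ 0)
    (n : ℕ) (t : Fin m → ℝ) (ht_pos : ∀ k, 0 < t k) (ht_mono : StrictMono t) :
    -- the objects are the intended ones
    (∀ j : ℕ, MeasureTheory.IntegrableOn
        (fun x => x ^ j * LaguerreJump.weight α ω t x) (Set.Ioi (0 : ℝ))) ∧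
    (∀ i : ℕ, (LaguerreJump.P α ω t i).Monic ∧ (LaguerreJump.P α ω t i).natDegree = i) ∧
    (∀ i j : ℕ, LaguerreJump.pairing α ω t (LaguerreJump.P α ω t i) (LaguerreJump.P α ω t j) =
        if i = j then LaguerreJump.h α ω i t else 0) ∧
    (∀ i : ℕ, 0 < LaguerreJump.h α ω i t) ∧
    0 < LaguerreJump.hankel α ω n t ∧
    ContDiffAt ℝ ((⊤ : ℕ∞) : WithTop ℕ∞) (LaguerreJump.hankel α ω n) t ∧
    ContDiffAt ℝ ((⊤ : ℕ∞) : WithTop ℕ∞) (LaguerreJump.sigma α ω n) t ∧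
    (∀ k, ContDiffAt ℝ ((⊤ : ℕ∞) : WithTop ℕ∞) (LaguerreJump.R α ω n k) t) ∧
    (∀ k, ContDiffAt ℝ ((⊤ : ℕ∞) : WithTop ℕ∞) (LaguerreJump.r α ω n k) t) ∧
    -- first Riccati-type equation
    (∀ k, LaguerreJump.delta (LaguerreJump.R α ω n k) t =
        2 * LaguerreJump.r α ω n k t +
          (∑ j, t j * LaguerreJump.R α ω n j t - t k + 2 * n + α) * LaguerreJump.R α ω n k t) ∧
    -- the identities with denominators, where these do not vanish
    ((∀ k, ω k.succ ≠ 0 → LaguerreJump.R α ω n k t ≠ 0) →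
      ∑ j, LaguerreJump.R α ω n j t ≠ 1 →
      -- second Riccati-type equation
      (∀ k, LaguerreJump.delta (LaguerreJump.r α ω n k) t =
        LaguerreJump.r α ω n k t ^ 2 / LaguerreJump.R α ω n k t -
          LaguerreJump.R α ω n k t *
            ((n + α + ∑ j, LaguerreJump.r α ω n j t) * (n + ∑ j, LaguerreJump.r α ω n j t) /
                (1 - ∑ j, LaguerreJump.R α ω n j t) +
              ∑ j, LaguerreJump.r α ω n j t ^ 2 / LaguerreJump.R α ω n j t)) ∧
      -- coupled second order system for the `R_{n,k}`
      (∀ k, LaguerreJump.delta2 (LaguerreJump.R α ω n k) t +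
          (t k - ∑ j ∈ Finset.univ.erase k, t j * LaguerreJump.R α ω n j t -
            2 * t k * LaguerreJump.R α ω n k t - 2 * n - α) *
              LaguerreJump.delta (LaguerreJump.R α ω n k) t -
          LaguerreJump.R α ω n k t *
            ∑ j ∈ Finset.univ.erase k, t j * LaguerreJump.delta (LaguerreJump.R α ω n j) t =
        ((2 * (n + α) + ∑ j, LaguerreJump.twoR α ω n j t) *
              (2 * n + ∑ j, LaguerreJump.twoR α ω n j t) /
              (2 * (∑ j, LaguerreJump.R α ω n j t - 1)) -
            ∑ j, LaguerreJump.twoR α ω n j t ^ 2 / (2 * LaguerreJump.R α ω n j t) +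
            ∑ j, t j * LaguerreJump.R α ω n j t - t k) * LaguerreJump.R α ω n k t +
          LaguerreJump.twoR α ω n k t ^ 2 / (2 * LaguerreJump.R α ω n k t)) ∧
      -- expression for `σ_n`
      LaguerreJump.sigma α ω n t =
        (n + α + ∑ k, LaguerreJump.r α ω n k t) * (n + ∑ k, LaguerreJump.r α ω n k t) /
            (∑ k, LaguerreJump.R α ω n k t - 1) -
          ∑ k, LaguerreJump.r α ω n k t ^ 2 / LaguerreJump.R α ω n k t +
          ∑ k, t k * LaguerreJump.r α ω n k t + n * (n + α)) ∧
    -- the explicit form of `δ²`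
    (∀ k, LaguerreJump.delta (LaguerreJump.delta (LaguerreJump.R α ω n k)) t =
        LaguerreJump.delta2 (LaguerreJump.R α ω n k) t) ∧
    -- the generalized `σ`-form
    (∀ k, 0 ≤ LaguerreJump.Delta α ω n k t) ∧
    (∑ k : Fin m, Real.sign (ω k.succ) * Real.sqrt (LaguerreJump.Delta α ω n k t) -
          2 * (LaguerreJump.delta (LaguerreJump.sigma α ω n) t -
            LaguerreJump.sigma α ω n t + n * (n + α))) ^ 2 -
        (∑ k : Fin m, ∑ j : Fin m,
          t j * LaguerreJump.pd k (LaguerreJump.pd j (LaguerreJump.sigma α ω n)) t) ^ 2 =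
      4 * (LaguerreJump.delta (LaguerreJump.sigma α ω n) t -
            LaguerreJump.sigma α ω n t + n * (n + α)) *
        (n + α + ∑ k, LaguerreJump.pd k (LaguerreJump.sigma α ω n) t) *
        (n + ∑ k, LaguerreJump.pd k (LaguerreJump.sigma α ω n) t) := by
  have hA : LaguerreJump.Admissible α ω := ⟨hα, hω, hω_ne⟩
  have ht : t ∈ LaguerreJump.chamber m := ⟨ht_pos, ht_mono⟩
  have htwo : ∀ k, LaguerreJump.twoR α ω n k t = 2 * LaguerreJump.r α ω n k t := fun k => by
    rw [LaguerreJump.twoR, hA.delta_R ht n k]; ring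
  refine ⟨fun j => LaguerreJump.integrableOn_pow_mul_weight hα j,
    LaguerreJump.P_monic_natDegree α ω t, fun i j => ?_, hA.h_pos ht, hA.hankel_pos ht n,
    hA.contDiffAt_hankel ht n, hA.contDiffAt_sigma ht n, hA.contDiffAt_R ht n,
    hA.contDiffAt_r ht n, hA.delta_R ht n, fun hR hsum => ?_,
    fun k => LaguerreJump.delta_delta (hA.contDiffAt_R ht n k), ?_⟩
  · rw [LaguerreJump.pairing_eq_mu hα ht_pos]
    split_ifs with hij
    · rw [hij, hA.h_eq ht]
    · rcases lt_or_gt_of_ne hij with h | h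
      · rw [mul_comm]; exact hA.mu_P_mul_P ht _ _ h
      · exact hA.mu_P_mul_P ht _ _ h
  · obtain ⟨hβ, hδ⟩ := hA.coupled_system ht n hR hsum
    -- The definition of β_n solved for σ_n; substituting the rational expression for β_n yields the
    -- formula for σ_n.
    have hσ : LaguerreJump.sigma α ω n t = ∑ k, t k * LaguerreJump.r α ω n k t + n * (n + α) -
        LaguerreJump.betaExpr α ω n t := by
      rw [LaguerreJump.betaExpr, hA.delta_sigma ht]; ring
    have hneg : ∀ N : ℝ, N / (∑ j, LaguerreJump.R α ω n j t - 1) =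
        -(N / (1 - ∑ j, LaguerreJump.R α ω n j t)) := fun N => by
      rw [← div_neg, neg_sub]
    refine ⟨fun k => by rw [hδ k, hβ], fun k => ?_, ?_⟩
    · have hsq : ∀ j, (2 * LaguerreJump.r α ω n j t) ^ 2 / (2 * LaguerreJump.R α ω n j t) =
          2 * (LaguerreJump.r α ω n j t ^ 2 / LaguerreJump.R α ω n j t) := fun j => by
        rw [mul_pow, show (2 : ℝ) ^ 2 = 2 * 2 by norm_num, mul_assoc,
          mul_div_mul_left _ _ two_ne_zero, mul_div_assoc]
      rw [← LaguerreJump.delta_delta (hA.contDiffAt_R ht n k), hA.delta_delta_R ht n k, hδ k,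
        Finset.sum_erase_eq_sub (Finset.mem_univ k), Finset.sum_erase_eq_sub (Finset.mem_univ k)]
      simp only [htwo, hsq]
      have hfrac : ∀ A B D : ℝ, 2 * A * (2 * B) / (2 * D) = 2 * (A * B / D) := fun A B D => by
        rw [mul_assoc, mul_div_mul_left _ _ two_ne_zero, mul_left_comm, mul_div_assoc]
      rw [← Finset.mul_sum, ← Finset.mul_sum, ← mul_add, ← mul_add, hfrac, hneg]
      linear_combination -2 * LaguerreJump.R α ω n k t * hβ
    · rw [hσ, hβ, hneg]; ring
  · obtain ⟨ρ, hδ, hquad, hD, hsqrt⟩ := hA.sign_mul_sqrt_Delta ht n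
    refine ⟨fun k => by rw [hD]; exact sq_nonneg _, ?_⟩
    have hβ : LaguerreJump.delta (LaguerreJump.sigma α ω n) t - LaguerreJump.sigma α ω n t +
        n * (n + α) = LaguerreJump.betaExpr α ω n t := rfl
    simp only [hsqrt, hA.mixed_eq ht, hA.pd_sigma ht, hδ, hβ]
    rw [← Finset.mul_sum, ← Finset.mul_sum, Finset.sum_add_distrib, Finset.sum_sub_distrib]
    -- With a = ∑ρ_k and b = ∑R_{n,k}, the left side is β²((a + b - 2)² - (a - b)²) = 4β²(1 - a)(1 -
    -- b), which is 4β times the left side of the quadratic relation.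
    linear_combination 4 * LaguerreJump.betaExpr α ω n t * hquad
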